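/- Let $S^3=\{[x_0:\dots:x_4]\in\mathbb{RP}^4 : x_1^2+x_2^2+x_3^2+x_4^2=x_0^2\}$. Consider $5$-tuples $(p_0,\dots,p_4)$ of real binary forms of degree $6$ in $(s,t)$, taken up to a common nonzero real factor, as points $[p_0:\dots:p_4]$ of the projective space $\mathbb{RP}^{34}$ of their coefficients. Let $X\subset\mathbb{RP}^{34}$ be the subspace of those $[p_0:\dots:p_4]$ for which $p_0,\dots,p_4$ have no common root in $\mathbb{CP}^1$ and $p_1^2+p_2^2+p_3^2+p_4^2=p_0^2$; that is, $X$ is the space of real regular maps of degree $6$ from $\mathbb{RP}^1$ to $S^3$. Let $X^\circ\subset X$ be the subspace of those maps whose complexification $\mathbb{CP}^1\to\mathbb{CP}^4$ is birational onto its image (only finitely many points of $\mathbb{CP}^1$ share their image with another point); these are the parametrizations of (possibly singular) real rational curves of degree $6$ in $S^3$. Let $\mathcal C$ be the space of real rational curves of degree $6$ in $S^3$, that is, the quotient space of $X^\circ$ in which two parametrizations are identified when they have the same image in $\mathbb{CP}^4$. Theorem. The space of real rational curves of degree $6$ in $S^3$ is path-connected: the spaces $X$, $X^\circ$ and $\mathcal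 C$ are (nonempty and) path-connected. -/

import Mathlib

open scoped LinearAlgebra.Projectivization

/-- Real projective space (over a topological vector space) carries the quotient topology of the
space of nonzero vectors. -/
instance projectivizationTopology {V : Type*} [AddCommGroup V] [Module ℝ V] [TopologicalSpace V] :
    TopologicalSpace (ℙ ℝ V) :=
  inferInstanceAs (TopologicalSpace (Quotient (projectivizationSetoid ℝ V)))

/-- A `5`-tuple `(p₀, …, p₄)` of real binary forms of degree `d`, given by coefficients:
`p i j` is the coefficient of `s ^ j * t ^ (d - j)` in the form `pᵢ(s, t)`. -/
abbrev FormTuple (d : ℕ) : Type := Fin 5 → Fin (d + 1) → ℝ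

/-- The vector `(p₀(s, t), …, p₄(s, t))` with `(s, t) = (z 0, z 1)`, over `K = ℝ` or `K = ℂ`. -/
noncomputable def evalTuple {d : ℕ} (K : Type*) [Field K] [Algebra ℝ K]
    (p : FormTuple d) (z : Fin 2 → K) : Fin 5 → K :=
  fun i => ∑ j : Fin (d + 1), algebraMap ℝ K (p i j) * z 0 ^ (j : ℕ) * z 1 ^ (d - (j : ℕ))

/-- The forms `p₀, …, p₄` have no common root in the complex projective line. -/
def NoCommonRoot {d : ℕ} (p : FormTuple d) : Prop :=
  ∀ z : Fin 2 → ℂ, z ≠ 0 → evalTuple ℂ p z ≠ 0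

/-- The real curve `[p₀ : … : p₄]` lies in the quadric
`S³ = {x₁² + x₂² + x₃² + x₄² = x₀²}` of real projective `4`-space. -/
def LiesInSphere {d : ℕ} (p : FormTuple d) : Prop :=
  ∀ z : Fin 2 → ℝ, evalTuple ℝ p z 1 ^ 2 + evalTuple ℝ p z 2 ^ 2 + evalTuple ℝ p z 3 ^ 2
    + evalTuple ℝ p z 4 ^ 2 = evalTuple ℝ p z 0 ^ 2

/-- The regular map `ℂP¹ → ℂP⁴` defined by a tuple of forms without common root. -/
noncomputable def complexMap {d : ℕ} (p : FormTuple d) (hp : NoCommonRoot p)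
    (x : ℙ ℂ (Fin 2 → ℂ)) : ℙ ℂ (Fin 5 → ℂ) :=
  Projectivization.mk ℂ (evalTuple ℂ p x.rep) (hp x.rep x.rep_nonzero)

/-- The regular map `ℂP¹ → ℂP⁴` is birational onto its image: only finitely many points of `ℂP¹`
share their image with another point. -/
def IsBirationalOntoImage {d : ℕ} (p : FormTuple d) (hp : NoCommonRoot p) : Prop :=
  {x : ℙ ℂ (Fin 2 → ℂ) | ∃ y, y ≠ x ∧ complexMap p hp y = complexMap p hp x}.Finite

theorem evalTuple_smul {d : ℕ} (K : Type*) [Field K] [Algebra ℝ K] (a : ℝ) (p : FormTuple d)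
    (z : Fin 2 → K) : evalTuple K (a • p) z = algebraMap ℝ K a • evalTuple K p z := by
  funext i
  simp [evalTuple, Finset.mul_sum, mul_assoc]

theorem evalTuple_smul_point {d : ℕ} (K : Type*) [Field K] [Algebra ℝ K] (p : FormTuple d)
    (c : K) (z : Fin 2 → K) : evalTuple K p (c • z) = c ^ d • evalTuple K p z := by
  funext i
  simp only [evalTuple, Pi.smul_apply, smul_eq_mul, Finset.mul_sum]
  refine Finset.sum_congr rfl fun j _ => ?_
  have hj : (j : ℕ) + (d - (j : ℕ)) = d := by omega
  have hc : c ^ d = c ^ (j : ℕ) * c ^ (d - (j : ℕ)) := by rw [← pow_add, hj]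
  rw [mul_pow, mul_pow, hc]
  ring

/-- The value of `complexMap` may be computed on any homogeneous coordinates of the point. -/
theorem complexMap_mk {d : ℕ} (p : FormTuple d) (hp : NoCommonRoot p) (z : Fin 2 → ℂ)
    (hz : z ≠ 0) :
    complexMap p hp (Projectivization.mk ℂ z hz)
      = Projectivization.mk ℂ (evalTuple ℂ p z) (hp z hz) := by
  obtain ⟨a, ha⟩ := Projectivization.exists_smul_eq_mk_rep ℂ z hz
  unfold complexMap
  rw [Projectivization.mk_eq_mk_iff']
  refine ⟨(a : ℂ) ^ d, ?_⟩
  rw [← evalTuple_smul_point, ← ha]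
  rfl

theorem noCommonRoot_smul {d : ℕ} (a : ℝˣ) (p : FormTuple d) :
    NoCommonRoot (a • p) ↔ NoCommonRoot p := by
  have h : ∀ z, evalTuple ℂ (a • p) z = (a : ℂ) • evalTuple ℂ p z := fun z =>
    evalTuple_smul ℂ (a : ℝ) p z
  simp [NoCommonRoot, h]

theorem liesInSphere_smul {d : ℕ} (a : ℝˣ) (p : FormTuple d) :
    LiesInSphere (a • p) ↔ LiesInSphere p := by
  have h : ∀ z, evalTuple ℝ (a • p) z = (a : ℝ) • evalTuple ℝ p z := fun z =>
    evalTuple_smul ℝ (a : ℝ) p z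
  have ha : ((a : ℝ)) ^ 2 ≠ 0 := pow_ne_zero _ a.ne_zero
  refine forall_congr' fun z => ?_
  simp only [h, Pi.smul_apply, smul_eq_mul, mul_pow, ← mul_add]
  exact mul_right_inj' ha

theorem complexMap_smul {d : ℕ} (a : ℝˣ) (p : FormTuple d) (hp : NoCommonRoot p)
    (hp' : NoCommonRoot (a • p)) : complexMap (a • p) hp' = complexMap p hp := by
  funext x
  unfold complexMap
  rw [Projectivization.mk_eq_mk_iff']
  exact ⟨((a : ℝ) : ℂ), (evalTuple_smul ℂ (a : ℝ) p x.rep).symm⟩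

/-- The space of regular maps `[p₀ : … : p₄]` of degree `d` from the projective line to the
sphere, as a subspace of the projective space of all `5`-tuples of forms. -/
def sphereMaps (d : ℕ) : Set (ℙ ℝ (FormTuple d)) :=
  {k | NoCommonRoot k.rep ∧ LiesInSphere k.rep}

/-- The space of parametrizations of real rational curves of degree `d` in the sphere: the regular
maps of degree `d` to the sphere that are birational onto their image. -/
def sphereParametrizations (d : ℕ) : Set (ℙ ℝ (FormTuple d)) :=
  {k | ∃ h : NoCommonRoot k.rep, LiesInSphere k.rep ∧ IsBirationalOntoImage k.rep h}

/-- Membership does not depend on the homogeneous coordinates. -/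
theorem mk_mem_sphereMaps {d : ℕ} (p : FormTuple d) (hp : p ≠ 0) :
    Projectivization.mk ℝ p hp ∈ sphereMaps d ↔ NoCommonRoot p ∧ LiesInSphere p := by
  obtain ⟨a, ha⟩ := Projectivization.exists_smul_eq_mk_rep ℝ p hp
  simp only [sphereMaps, Set.mem_ofPred_eq, ← ha, noCommonRoot_smul, liesInSphere_smul]

/-- Membership does not depend on the homogeneous coordinates. -/
theorem mk_mem_sphereParametrizations {d : ℕ} (p : FormTuple d) (hp : p ≠ 0) :
    Projectivization.mk ℝ p hp ∈ sphereParametrizations d ↔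
      ∃ h : NoCommonRoot p, LiesInSphere p ∧ IsBirationalOntoImage p h := by
  obtain ⟨a, ha⟩ := Projectivization.exists_smul_eq_mk_rep ℝ p hp
  simp only [sphereParametrizations, Set.mem_ofPred_eq, ← ha, liesInSphere_smul]
  constructor
  · rintro ⟨h, h1, h2⟩
    have h' := (noCommonRoot_smul a p).1 h
    refine ⟨h', h1, ?_⟩
    rwa [IsBirationalOntoImage, complexMap_smul a p h' h] at h2
  · rintro ⟨h, h1, h2⟩
    have h' := (noCommonRoot_smul a p).2 h
    refine ⟨h', h1, ?_⟩
    rwa [IsBirationalOntoImage, complexMap_smul a p h h']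

/-- The set of complex points in `ℂP⁴` of the curve with a given parametrization. -/
noncomputable def curveOf {d : ℕ} (k : sphereParametrizations d) : Set (ℙ ℂ (Fin 5 → ℂ)) :=
  Set.range (complexMap k.1.rep k.2.1)

/-- The space of real rational curves of degree `d` in the sphere: parametrizations, two of them
being identified when they parametrize the same curve, with the quotient topology. -/
abbrev SphereCurves (d : ℕ) : Type :=
  Quotient (Setoid.ker (curveOf (d := d)))

/-! Write a map as the real form `p₀` together with the pair `w = (p₁ + i p₂, p₃ + i p₄)` of complex
polynomials, that is, as a quaternionic polynomial. The sphere equation becomes `N(w) = p₀²` for the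
multiplicative norm `N = hermNorm`. A map without common roots has no real zero of `p₀`, even at
infinity, so after a change of sign `p₀ > 0` is a constant times three real quadratics with roots
`z₀, z₁, z₂` in the upper half plane and their conjugates. Each root of the norm lets `w` split off
a linear quaternionic factor on the left (`exists_eq_linFactor`); each quadratic occurs squared in
`N(w)`, hence gives a block of two factors with the same root and directions `a` and `a + ζ J a`.
Thus every map with `p₀ > 0` arises from parameters `(z, a, ζ, c)` (`exists_param`), on which it
depends continuously.

Call the parameters generic if the `zₖ` are distinct and the hyperplane section `p₀ = 0` sends `z₀`
to a point separated, by one ruling of the quadric surface `x₀ = 0`, from the images of the five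
other roots. A simple root with a separated image forces birationality: a resultant bounding the
multiple points is then nonzero (`finite_collisions`). Generic parameters are the continuous image
of a product of complements of finitely many points in complex vector spaces, so they form a
path-connected set (`isPathConnected_genericParam`). Genericity away from the positivity conditions
is the nonvanishing of real-analytic functions, so a short initial piece of a segment towards
generic parameters is generic apart from its starting point (`eventually_isGenericParam`). Hence
every map is joined to the connected generic locus without leaving the given space. -/

open Polynomial

/-! ### Finiteness of multiple points through Bézout quotients and resultants. -/

/-- Finitely many vectors outside a line are simultaneously nonzero under some linear form that
vanishes on the line. -/
theorem exists_linearForm_ne_zero {ι α : Type*} [Fintype ι] (v : ι → ℂ) (hv : v ≠ 0)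
    (s : Finset α) (u : α → ι → ℂ) (hu : ∀ ρ ∈ s, ∀ κ : ℂ, u ρ ≠ κ • v) :
    ∃ c : ι → ℂ, ∑ i, c i * v i = 0 ∧ ∀ ρ ∈ s, ∑ i, c i * u ρ i ≠ 0 := by
  classical
  let φ : (ι → ℂ) → ((ι → ℂ) →ₗ[ℂ] ℂ) := fun w => ∑ i, w i • LinearMap.proj i
  have hφ : ∀ w c, φ w c = ∑ i, c i * w i := fun w c => by
    simp [φ, LinearMap.sum_apply, mul_comm]
  let E := LinearMap.ker (φ v)
  let K : s → Submodule ℂ E := fun ρ => LinearMap.ker ((φ (u ρ)).comp E.subtype)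
  have hK : ¬ ∃ ρ, K ρ = ⊤ := by
    rintro ⟨ρ, hρ⟩
    obtain ⟨i, hi⟩ := Function.ne_iff.1 hv
    refine hu ρ ρ.2 (u ρ i / v i) (funext fun j => ?_)
    have hmem : v i • Pi.single j (1 : ℂ) - v j • Pi.single i (1 : ℂ) ∈ E := by
      simp [E, hφ, sub_mul, Finset.sum_sub_distrib, Pi.single_apply]
      ring
    have h0 : (⟨_, hmem⟩ : E) ∈ K ρ := hρ ▸ Submodule.mem_top
    simp only [K, LinearMap.mem_ker, LinearMap.comp_apply, Submodule.subtype_apply, hφ] at h0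
    simp [sub_mul, Finset.sum_sub_distrib, Pi.single_apply] at h0
    have hi' : v i ≠ 0 := hi
    simp only [Pi.smul_apply, smul_eq_mul]
    field_simp
    linear_combination h0
  -- A vector space over an infinite field is not a finite union of proper subspaces.
  have hne : ⋃ ρ, (K ρ : Set E) ≠ Set.univ := fun h =>
    hK (Subspace.exists_eq_top_of_iUnion_eq_univ h)
  obtain ⟨c, hc⟩ := (Set.ne_univ_iff_exists_notMem _).1 hne
  refine ⟨c.1, by rw [← hφ]; exact c.2, fun ρ hρ h0 => hc ?_⟩
  refine Set.mem_iUnion.2 ⟨⟨ρ, hρ⟩, ?_⟩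
  simpa [K, hφ] using h0

/-- The bivariate polynomial `p(x) q(y) - q(x) p(y)` as a polynomial in `y`. -/
noncomputable def crossPoly (p q : ℂ[X]) : ℂ[X][X] := C p * q.map C - C q * p.map C

/-- The bivariate polynomial `(p(x) q(y) - q(x) p(y)) / (y - x)` as a polynomial in `y`. -/
noncomputable def bezoutPoly (p q : ℂ[X]) : ℂ[X][X] := crossPoly p q /ₘ (X - C X)

theorem X_sub_C_mul_bezoutPoly (p q : ℂ[X]) : (X - C X) * bezoutPoly p q = crossPoly p q := by
  rw [bezoutPoly, mul_divByMonic_eq_iff_isRoot]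
  have h : ∀ r : ℂ[X], eval X (r.map C) = r := fun r => by
    rw [eval_map, eval₂_C_X]
  simp [crossPoly, IsRoot, h, mul_comm]

theorem X_sub_C_mul_map_bezoutPoly (p q : ℂ[X]) (x : ℂ) :
    (X - C x) * (bezoutPoly p q).map (evalRingHom x) = C (p.eval x) * q - C (q.eval x) * p := by
  have h := congrArg (Polynomial.map (evalRingHom x)) (X_sub_C_mul_bezoutPoly p q)
  have h2 : (evalRingHom x).comp C = RingHom.id ℂ := RingHom.ext fun _ => by simp
  simpa [crossPoly, Polynomial.map_mul, Polynomial.map_sub, Polynomial.map_map, h2] using h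

theorem natDegree_bezoutPoly_le {p q : ℂ[X]} {n : ℕ} (hp : p.natDegree ≤ n + 1)
    (hq : q.natDegree ≤ n + 1) : (bezoutPoly p q).natDegree ≤ n := by
  rw [bezoutPoly, natDegree_divByMonic _ (monic_X_sub_C _), natDegree_X_sub_C]
  have h : (crossPoly p q).natDegree ≤ n + 1 := by
    refine (natDegree_sub_le _ _).trans (max_le ?_ ?_)
    · exact (natDegree_C_mul_le _ _).trans (natDegree_map_le.trans hq)
    · exact (natDegree_C_mul_le _ _).trans (natDegree_map_le.trans hp)
  omega

theorem resultant_eq_zero_of_common_root {R : Type*} [CommRing R] (f g : R[X])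
    (m n : ℕ) (hf : f.natDegree ≤ m) (hg : g.natDegree ≤ n) (hm : m ≠ 0) (y : R)
    (hfy : f.eval y = 0) (hgy : g.eval y = 0) : resultant f g m n = 0 := by
  obtain ⟨p, q, -, -, h⟩ := exists_mul_add_mul_eq_C_resultant f g hf hg (Or.inl hm)
  have := congrArg (eval y) h
  simpa [hfy, hgy] using this.symm

/-- The formal degree `n` may exceed the degree of `q`. As the degree of `p` is exact, the excess
only contributes a power of the nonzero leading coefficient of `p`. -/
theorem resultant_ne_zero_of_no_common_root {p q : ℂ[X]} {n : ℕ} (hp0 : p ≠ 0)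
    (hq : q.natDegree ≤ n) (h : ∀ x, p.eval x = 0 → q.eval x ≠ 0) :
    resultant p q p.natDegree n ≠ 0 := by
  obtain ⟨k, rfl⟩ := Nat.exists_eq_add_of_le hq
  rw [resultant_add_right_deg _ _ _ _ _ le_rfl]
  refine mul_ne_zero (pow_ne_zero _ (leadingCoeff_ne_zero.2 hp0)) ?_
  rw [Ne, resultant_eq_zero_iff]
  refine fun h' => h'.2 ((isCoprime_iff_aeval_ne_zero_of_isAlgClosed ℂ ℂ p q).2 fun x => ?_)
  simpa only [coe_aeval_eq_eval, Ne, ← not_and_or, not_and] using h x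

/-- A planar rational curve `[p : f : g]` has finitely many multiple points as soon as the line
`p = 0` meets the curve at a point with a single simple preimage, which is cut out by `f = 0`. -/
theorem finite_collisions {p f g : ℂ[X]} {n : ℕ} (hp : p.natDegree = n + 2)
    (hf : f.natDegree ≤ n + 2) (hg : g.natDegree ≤ n + 2) {z : ℂ} (hpz : p.eval z = 0)
    (hpz' : p.derivative.eval z ≠ 0) (hfz : f.eval z = 0) (hgz : g.eval z ≠ 0)
    (h : ∀ x, p.eval x = 0 → f.eval x = 0 → x = z) :
    {x : ℂ | ∃ y, y ≠ x ∧ p.eval x * g.eval y = g.eval x * p.eval y ∧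
      f.eval x * g.eval y = g.eval x * f.eval y}.Finite := by
  let D := bezoutPoly p g
  let E := bezoutPoly f g
  have hD : D.natDegree ≤ n + 1 := natDegree_bezoutPoly_le hp.le hg
  have hE : E.natDegree ≤ n + 1 := natDegree_bezoutPoly_le hf hg
  -- Eliminating `y` from the two quotients leaves a polynomial in `x` that vanishes at every
  -- collision; it remains to see that it is not zero, by evaluating it at `z`.
  let r : ℂ[X] := resultant D E (n + 1) (n + 1)
  have hr : ∀ x, r.eval x =
      resultant (D.map (evalRingHom x)) (E.map (evalRingHom x)) (n + 1) (n + 1) := fun x => by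
    rw [resultant_map_map]; rfl
  have hDz : (X - C z) * D.map (evalRingHom z) = - C (g.eval z) * p := by
    rw [X_sub_C_mul_map_bezoutPoly, hpz]; simp
  have hEz : (X - C z) * E.map (evalRingHom z) = - C (g.eval z) * f := by
    rw [X_sub_C_mul_map_bezoutPoly, hfz]; simp
  have hp0 : p ≠ 0 := by rintro rfl; simp at hpz'
  have hC : (- C (g.eval z) : ℂ[X]) ≠ 0 := by simpa using hgz
  have hD0 : D.map (evalRingHom z) ≠ 0 := by
    intro h0
    rw [h0, mul_zero] at hDz
    exact mul_ne_zero hC hp0 hDz.symm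
  have hDdeg : (D.map (evalRingHom z)).natDegree = n + 1 := by
    have h1 := congrArg natDegree hDz
    rw [natDegree_mul (X_sub_C_ne_zero z) hD0, natDegree_X_sub_C, ← C_neg,
      natDegree_C_mul (by simpa using hgz), hp] at h1
    omega
  have hr0 : r ≠ 0 := by
    intro h0
    have h1 := hr z
    rw [h0, eval_zero] at h1
    refine resultant_ne_zero_of_no_common_root hD0 (natDegree_map_le.trans hE) ?_
      (by rw [hDdeg]; exact h1.symm)
    -- At `x = z` the quotients are multiples of `p / (y - z)` and `f / (y - z)`. A common root is a
    -- common root of `p` and `f`, hence `z`; then `z` would be a double root of `p`.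
    intro x hx hx'
    have e1 := congrArg (eval x) hDz
    have e2 := congrArg (eval x) hEz
    simp [hx, hx', hgz] at e1 e2
    obtain rfl := h x e1 e2
    have e3 := congrArg (fun q => eval x (derivative q)) hDz
    simp [hx, hgz] at e3
    exact hpz' e3
  refine (r.rootSet_finite ℂ).subset ?_
  rintro x ⟨y, hyx, h1, h2⟩
  rw [mem_rootSet]
  refine ⟨hr0, ?_⟩
  have key : ∀ q : ℂ[X], q.eval x * g.eval y = g.eval x * q.eval y →
      ((bezoutPoly q g).map (evalRingHom x)).eval y = 0 := by
    intro q hq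
    have e := congrArg (eval y) (X_sub_C_mul_map_bezoutPoly q g x)
    simp only [eval_mul, eval_sub, eval_X, eval_C, hq, sub_self] at e
    exact (mul_eq_zero.1 e).resolve_left (sub_ne_zero.2 hyx)
  rw [coe_aeval_eq_eval, hr]
  exact resultant_eq_zero_of_common_root _ _ _ _ (natDegree_map_le.trans hD)
    (natDegree_map_le.trans hE) (by simp) y (key p h1) (key f h2)

/-- A rational curve in projective space has finitely many multiple points as soon as some
hyperplane meets it at a point with a single simple preimage. -/
theorem finite_collisions_of_separated_root {ι : Type*} [Fintype ι] {Q : ι → ℂ[X]} {n : ℕ} {i₀ : ι}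
    (h0 : (Q i₀).natDegree = n + 2) (hQ : ∀ i, (Q i).natDegree ≤ n + 2) {z : ℂ}
    (hz : (Q i₀).eval z = 0) (hz' : (Q i₀).derivative.eval z ≠ 0)
    (hQz : (fun i => (Q i).eval z) ≠ 0)
    (hsep : ∀ x, (Q i₀).eval x = 0 → x ≠ z → ∀ κ : ℂ,
      (fun i => (Q i).eval x) ≠ κ • fun i => (Q i).eval z)
    (hroot : ∃ x, (Q i₀).eval x = 0 ∧ x ≠ z) :
    {x : ℂ | ∃ y, y ≠ x ∧ ∃ κ : ℂ, ∀ i, (Q i).eval y = κ * (Q i).eval x}.Finite ∧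
    {x : ℂ | ∃ κ : ℂ, ∀ i, (Q i).eval x = κ * (Q i).coeff (n + 2)}.Finite := by
  classical
  have hp0 : Q i₀ ≠ 0 := by rintro h; simp [h] at h0
  obtain ⟨c, hc, hc'⟩ := exists_linearForm_ne_zero (fun i => (Q i).eval z) hQz
    ((Q i₀).roots.toFinset.erase z) (fun x i => (Q i).eval x) (by
      intro ρ hρ
      rw [Finset.mem_erase, Multiset.mem_toFinset, mem_roots hp0] at hρ
      exact hsep ρ hρ.2 hρ.1)
  -- Projecting to the plane by `Q i₀`, by this linear form and by a coordinate `Q j` not vanishing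
  -- at `z` reduces the claim to the planar case.
  let f : ℂ[X] := ∑ i, C (c i) * Q i
  have hfe : ∀ x, f.eval x = ∑ i, c i * (Q i).eval x := fun x => by simp [f, eval_finsetSum]
  have hfd : f.natDegree ≤ n + 2 := natDegree_sum_le_of_forall_le _ _ fun i _ =>
    (natDegree_C_mul_le _ _).trans (hQ i)
  have hfz : f.eval z = 0 := by rw [hfe]; exact hc
  have hfr : ∀ x, (Q i₀).eval x = 0 → f.eval x = 0 → x = z := by
    intro x hx hfx
    by_contra hxz
    refine hc' x ?_ (by rw [← hfe]; exact hfx)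
    rw [Finset.mem_erase, Multiset.mem_toFinset, mem_roots hp0]
    exact ⟨hxz, hx⟩
  obtain ⟨j, hj⟩ := Function.ne_iff.1 hQz
  constructor
  · refine (finite_collisions h0 hfd (hQ j) hz hz' hfz hj hfr).subset ?_
    rintro x ⟨y, hyx, κ, hκ⟩
    refine ⟨y, hyx, by rw [hκ, hκ]; ring, ?_⟩
    have : f.eval y = κ * f.eval x := by
      simp only [hfe, hκ, Finset.mul_sum]
      exact Finset.sum_congr rfl fun i _ => by ring
    rw [this, hκ]; ring
  -- The coefficients of degree `n + 2` are the value at infinity, so a point sharing its image with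
  -- infinity is a root of `q`. The other root `x₁` of `Q i₀` shows `q ≠ 0`, because `f` does not
  -- vanish there.
  · let q : ℂ[X] := C ((Q i₀).coeff (n + 2)) * f - C (f.coeff (n + 2)) * Q i₀
    obtain ⟨x₁, hx₁, hx₁z⟩ := hroot
    have hlead : (Q i₀).coeff (n + 2) ≠ 0 := by
      rw [← h0]; exact leadingCoeff_ne_zero.2 hp0
    have hq : q ≠ 0 := by
      intro h
      have := congrArg (eval x₁) h
      simp [q, hx₁, hlead] at this
      exact hx₁z (hfr _ hx₁ this)
    refine (q.rootSet_finite ℂ).subset ?_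
    rintro x ⟨κ, hκ⟩
    rw [mem_rootSet]
    refine ⟨hq, ?_⟩
    have : f.eval x = κ * f.coeff (n + 2) := by
      simp only [hfe, hκ, f, finsetSum_coeff, coeff_C_mul, Finset.mul_sum]
      exact Finset.sum_congr rfl fun i _ => by ring
    simp [q, this, hκ]
    ring

/-! ### Pairs of complex polynomials as quaternionic polynomials, and their linear factors. -/

open ComplexConjugate

/-- The polynomial with complex conjugate coefficients. -/
noncomputable abbrev barPoly (U : ℂ[X]) : ℂ[X] := U.map (starRingEnd ℂ)

theorem eval_barPoly (U : ℂ[X]) (t : ℂ) : (barPoly U).eval t = conj (U.eval (conj t)) := by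
  rw [eval_map, ← eval₂_hom, Complex.conj_conj]

/-- The Hermitian norm of a pair of polynomials; on real points it is `|U|² + |V|²`. -/
noncomputable def hermNorm (w : ℂ[X] × ℂ[X]) : ℂ[X] := w.1 * barPoly w.1 + w.2 * barPoly w.2

/-- The quaternionic structure `(x, y) ↦ (-ȳ, x̄)` of `ℂ²`. -/
def quatJ (a : ℂ × ℂ) : ℂ × ℂ := (-conj a.2, conj a.1)

/-- The determinant of two vectors of `ℂ²`. -/
def det₂ (a x : ℂ × ℂ) : ℂ := a.1 * x.2 - a.2 * x.1

/-- The Hermitian product of two vectors of `ℂ²`. -/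
def herm₂ (a x : ℂ × ℂ) : ℂ := conj a.1 * x.1 + conj a.2 * x.2

/-- The squared Hermitian norm of a vector of `ℂ²`. -/
def sqNorm (a : ℂ × ℂ) : ℝ := Complex.normSq a.1 + Complex.normSq a.2

/-- The value at `t` of the linear quaternionic polynomial with a root of argument `z` and left
direction `a`, up to the factor `|a|²`, as an endomorphism of `ℂ²`. -/
def linEval (z : ℂ) (a : ℂ × ℂ) (t : ℂ) (x : ℂ × ℂ) : ℂ × ℂ :=
  ((t - conj z) * herm₂ a x * a.1 - (t - z) * det₂ a x * conj a.2,
    (t - conj z) * herm₂ a x * a.2 + (t - z) * det₂ a x * conj a.1)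

/-- Left multiplication of a polynomial vector by the linear polynomial of `linEval`. -/
noncomputable def linFactor (z : ℂ) (a : ℂ × ℂ) (w : ℂ[X] × ℂ[X]) : ℂ[X] × ℂ[X] :=
  ((X - C (conj z)) * (C (conj a.1) * w.1 + C (conj a.2) * w.2) * C a.1
      - (X - C z) * (C a.1 * w.2 - C a.2 * w.1) * C (conj a.2),
    (X - C (conj z)) * (C (conj a.1) * w.1 + C (conj a.2) * w.2) * C a.2
      + (X - C z) * (C a.1 * w.2 - C a.2 * w.1) * C (conj a.1))

/-- Evaluation of a pair of polynomials. -/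
noncomputable def evalPair (t : ℂ) (w : ℂ[X] × ℂ[X]) : ℂ × ℂ := (w.1.eval t, w.2.eval t)

/-- The real quadratic polynomial with roots `z` and `z̄`. -/
noncomputable def quadPoly (z : ℂ) : ℝ[X] := X ^ 2 - C (2 * z.re) * X + C (Complex.normSq z)

theorem map_quadPoly (z : ℂ) :
    (quadPoly z).map Complex.ofRealHom = (X - C z) * (X - C (conj z)) := by
  have h1 : z + conj z = ((2 * z.re : ℝ) : ℂ) := Complex.add_conj z
  have h2 : z * conj z = (Complex.normSq z : ℂ) := Complex.mul_conj z
  simp only [quadPoly, Polynomial.map_add, Polynomial.map_sub, Polynomial.map_pow, map_X,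
    Polynomial.map_mul, map_C, Complex.ofRealHom_eq_coe, ← h2]
  rw [← h1, C_add, C_mul]
  ring

theorem eval_map_quadPoly (z t : ℂ) :
    ((quadPoly z).map Complex.ofRealHom).eval t = (t - z) * (t - conj z) := by
  simp [map_quadPoly]

theorem natDegree_quadPoly (z : ℂ) : (quadPoly z).natDegree = 2 := by
  have := natDegree_map_eq_of_injective Complex.ofRealHom.injective (quadPoly z)
  rw [← this, map_quadPoly, natDegree_mul (X_sub_C_ne_zero _) (X_sub_C_ne_zero _)]
  simp

theorem ofReal_sqNorm (a : ℂ × ℂ) : (sqNorm a : ℂ) = a.1 * conj a.1 + a.2 * conj a.2 := by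
  simp [sqNorm, Complex.mul_conj]

theorem sqNorm_pos {a : ℂ × ℂ} (ha : a ≠ 0) : 0 < sqNorm a := by
  have h1 := Complex.normSq_nonneg a.1
  have h2 := Complex.normSq_nonneg a.2
  refine (add_nonneg h1 h2).lt_of_ne fun h => ha ?_
  rw [eq_comm, add_eq_zero_iff_of_nonneg h1 h2] at h
  exact Prod.ext (Complex.normSq_eq_zero.1 h.1) (Complex.normSq_eq_zero.1 h.2)

theorem sqNorm_add_smul_quatJ (a : ℂ × ℂ) (ζ : ℂ) :
    sqNorm (a + ζ • quatJ a) = sqNorm a * (1 + Complex.normSq ζ) := by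
  rw [← Complex.ofReal_inj]
  push_cast [ofReal_sqNorm, ← Complex.mul_conj]
  simp [quatJ]
  ring

theorem quatJ_quatJ (a : ℂ × ℂ) : quatJ (quatJ a) = -a := by
  ext <;> simp [quatJ]

theorem herm₂_quatJ (a x : ℂ × ℂ) : herm₂ (quatJ a) x = det₂ a x := by
  simp [herm₂, det₂, quatJ]; ring

theorem det₂_quatJ_left (a x : ℂ × ℂ) : det₂ (quatJ a) x = -herm₂ a x := by
  simp [herm₂, det₂, quatJ]; ring

theorem det₂_quatJ_right (a x : ℂ × ℂ) : det₂ a (quatJ x) = conj (herm₂ a x) := by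
  simp [herm₂, det₂, quatJ]

theorem herm₂_quatJ_right (a x : ℂ × ℂ) : herm₂ a (quatJ x) = -conj (det₂ a x) := by
  simp [herm₂, det₂, quatJ]; ring

theorem herm₂_self (a : ℂ × ℂ) : herm₂ a a = sqNorm a := by
  rw [ofReal_sqNorm, herm₂]; ring

theorem det₂_self (a : ℂ × ℂ) : det₂ a a = 0 := by
  rw [det₂]; ring

theorem herm₂_smul (a : ℂ × ℂ) (r : ℂ) (x : ℂ × ℂ) : herm₂ a (r • x) = r * herm₂ a x := by
  simp [herm₂]; ring

theorem det₂_smul (a : ℂ × ℂ) (r : ℂ) (x : ℂ × ℂ) : det₂ a (r • x) = r * det₂ a x := by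
  simp [det₂]; ring

/-- The orthogonal decomposition of a vector along `a` and `J a`. -/
theorem sqNorm_smul_eq (a x : ℂ × ℂ) :
    (sqNorm a : ℂ) • x = herm₂ a x • a + det₂ a x • quatJ a := by
  rw [ofReal_sqNorm]
  ext <;> simp [herm₂, det₂, quatJ] <;> ring

theorem linEval_eq (z : ℂ) (a : ℂ × ℂ) (t : ℂ) (x : ℂ × ℂ) :
    linEval z a t x = ((t - conj z) * herm₂ a x) • a + ((t - z) * det₂ a x) • quatJ a := by
  ext <;> simp [linEval, quatJ]; ring

theorem linEval_smul (z : ℂ) (a : ℂ × ℂ) (t r : ℂ) (x : ℂ × ℂ) :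
    linEval z a t (r • x) = r • linEval z a t x := by
  ext <;> simp [linEval, herm₂, det₂] <;> ring

/-- The linear polynomial with the conjugate root is the adjugate. -/
theorem linEval_linEval_conj (z : ℂ) (a : ℂ × ℂ) (t : ℂ) (x : ℂ × ℂ) :
    linEval z a t (linEval (conj z) a t x)
      = ((sqNorm a : ℂ) ^ 2 * ((t - z) * (t - conj z))) • x := by
  rw [ofReal_sqNorm]
  ext <;> simp [linEval, herm₂, det₂] <;> ring

theorem linEval_conj_linEval (z : ℂ) (a : ℂ × ℂ) (t : ℂ) (x : ℂ × ℂ) :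
    linEval (conj z) a t (linEval z a t x)
      = ((sqNorm a : ℂ) ^ 2 * ((t - z) * (t - conj z))) • x := by
  rw [ofReal_sqNorm]
  ext <;> simp [linEval, herm₂, det₂] <;> ring

/-- Orthogonal directions at the same root multiply to a scalar polynomial. This is the degenerate
block that regularity excludes. -/
theorem linEval_linEval_smul_quatJ (z r : ℂ) (a : ℂ × ℂ) (t : ℂ) (x : ℂ × ℂ) :
    linEval z a t (linEval z (r • quatJ a) t x)
      = ((sqNorm a : ℂ) ^ 2 * (r * conj r) * ((t - z) * (t - conj z))) • x := by
  rw [ofReal_sqNorm]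
  ext <;> simp [linEval, herm₂, det₂, quatJ] <;> ring

theorem evalPair_linFactor (z : ℂ) (a : ℂ × ℂ) (t : ℂ) (w : ℂ[X] × ℂ[X]) :
    evalPair t (linFactor z a w) = linEval z a t (evalPair t w) := by
  ext <;> simp [linEval, herm₂, det₂, linFactor, evalPair]

/-- The factor scales the orthogonal vectors `a` and `J a` by `t - z̄` and `t - z`, which
conjugation of coefficients exchanges; so both components of the norm acquire the same quadratic
factor. -/
theorem hermNorm_linFactor (z : ℂ) (a : ℂ × ℂ) (w : ℂ[X] × ℂ[X]) :
    hermNorm (linFactor z a w)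
      = (C (sqNorm a ^ 2) * quadPoly z).map Complex.ofRealHom * hermNorm w := by
  rw [Polynomial.map_mul, map_quadPoly, map_C, Complex.ofRealHom_eq_coe, Complex.ofReal_pow,
    ofReal_sqNorm]
  simp [hermNorm, linFactor]
  ring

theorem eval_hermNorm (w : ℂ[X] × ℂ[X]) (t : ℂ) :
    (hermNorm w).eval t = herm₂ (evalPair (conj t) w) (evalPair t w) := by
  simp only [hermNorm, herm₂, eval_add, eval_mul, eval_barPoly, evalPair]
  ring

/-! ### Splitting off linear factors and blocks. -/

/-- A pair of polynomials is regular at `t` if its two entries and their conjugates do not vanish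
simultaneously at `t`. -/
def RegularAt (w : ℂ[X] × ℂ[X]) (t : ℂ) : Prop := evalPair t w ≠ 0 ∨ evalPair (conj t) w ≠ 0

theorem RegularAt.of_linFactor {z : ℂ} {a : ℂ × ℂ} {w : ℂ[X] × ℂ[X]} {t : ℂ}
    (h : RegularAt (linFactor z a w) t) : RegularAt w t := by
  have h0 : ∀ s, linEval z a s 0 = 0 := fun s => by simp [linEval, herm₂, det₂]
  unfold RegularAt at *
  rw [evalPair_linFactor, evalPair_linFactor] at h
  contrapose! h
  rw [h.1, h.2, h0, h0]
  simp

/-- A pair whose norm vanishes at a regular point splits off a linear factor on the left. -/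
theorem exists_eq_linFactor {w : ℂ[X] × ℂ[X]} {z : ℂ} (hw : RegularAt w z)
    (hN : (hermNorm w).eval z = 0) : ∃ a : ℂ × ℂ, a ≠ 0 ∧ ∃ w', w = linFactor z a w' := by
  -- The vanishing of the norm says that `w(z)` and `w(z̄)` are orthogonal, so `w(z)` serves as `a`,
  -- or `J w(z̄)` if `w(z) = 0`.
  have key : ∃ a : ℂ × ℂ, a ≠ 0 ∧ det₂ a (evalPair z w) = 0 ∧
      herm₂ a (evalPair (conj z) w) = 0 := by
    rw [eval_hermNorm] at hN
    rcases eq_or_ne (evalPair z w) 0 with h | h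
    · have h' := hw.resolve_left (not_not.2 h)
      refine ⟨quatJ (evalPair (conj z) w), fun h0 => h' ?_, ?_, ?_⟩
      · have := congrArg quatJ h0
        rwa [quatJ_quatJ, show quatJ 0 = 0 by simp [quatJ], neg_eq_zero] at this
      · rw [h]; simp [det₂]
      · rw [herm₂_quatJ, det₂_self]
    · refine ⟨_, h, det₂_self _, ?_⟩
      have := congrArg conj hN
      simp only [herm₂, map_add, map_mul, Complex.conj_conj, map_zero] at this ⊢
      linear_combination this
  obtain ⟨a, ha, h1, h2⟩ := key
  refine ⟨a, ha, ?_⟩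
  have hn : (sqNorm a : ℂ) ≠ 0 := by exact_mod_cast (sqNorm_pos ha).ne'
  obtain ⟨g, hg⟩ : X - C z ∣ C a.1 * w.2 - C a.2 * w.1 := by
    rw [dvd_iff_isRoot]; simpa [det₂, evalPair] using h1
  obtain ⟨f, hf⟩ : X - C (conj z) ∣ C (conj a.1) * w.1 + C (conj a.2) * w.2 := by
    rw [dvd_iff_isRoot]; simpa [herm₂, evalPair] using h2
  have hc : C ((sqNorm a : ℂ)⁻¹ ^ 2) * C (sqNorm a : ℂ) ^ 2 = 1 := by
    rw [← C_pow, ← C_mul, ← mul_pow, inv_mul_cancel₀ hn, one_pow, C_1]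
  have hs : (C (sqNorm a : ℂ) : ℂ[X]) = C a.1 * C (conj a.1) + C a.2 * C (conj a.2) := by
    rw [ofReal_sqNorm, C_add, C_mul, C_mul]
  rw [hs] at hc
  set k := C ((sqNorm a : ℂ)⁻¹ ^ 2)
  -- In the basis `a`, `J a` the coordinates of `w` are divisible by `X - z̄` and `X - z`; the
  -- quotient is `|a|⁻⁴ (f a + g J a)`.
  refine ⟨(k * (f * C a.1 - g * C (conj a.2)), k * (f * C a.2 + g * C (conj a.1))), ?_⟩
  ext1
  · simp only [linFactor]
    linear_combination (-w.1) * hc + k * (C a.1 * C (conj a.1) + C a.2 * C (conj a.2)) *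
      (C a.1 * hf - C (conj a.2) * hg)
  · simp only [linFactor]
    linear_combination (-w.2) * hc + k * (C a.1 * C (conj a.1) + C a.2 * C (conj a.2)) *
      (C a.2 * hf + C (conj a.1) * hg)

/-- The product of two linear factors with the same root `z`, the second direction being
`a + ζ J a`. -/
noncomputable def blockFactor (z : ℂ) (a : ℂ × ℂ) (ζ : ℂ) (w : ℂ[X] × ℂ[X]) : ℂ[X] × ℂ[X] :=
  linFactor z a (linFactor z (a + ζ • quatJ a) w)

/-- The value of `blockFactor`. -/
def blockEval (z : ℂ) (a : ℂ × ℂ) (ζ : ℂ) (t : ℂ) (x : ℂ × ℂ) : ℂ × ℂ :=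
  linEval z a t (linEval z (a + ζ • quatJ a) t x)

/-- Only the line spanned by a direction matters: its scale is a positive constant that passes to
the right-hand factor. -/
theorem linFactor_smul_left (z r : ℂ) (a : ℂ × ℂ) (w : ℂ[X] × ℂ[X]) :
    linFactor z (r • a) w = linFactor z a (C (Complex.normSq r : ℂ) * w.1,
      C (Complex.normSq r : ℂ) * w.2) := by
  rw [← Complex.mul_conj]
  ext1 <;> simp [linFactor] <;> ring

/-- A pair whose norm vanishes doubly at a non-real regular point splits off a block. -/
theorem exists_eq_blockFactor {w : ℂ[X] × ℂ[X]} {z : ℂ} (hw : RegularAt w z) {R : ℂ[X]}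
    (hN : hermNorm w = (quadPoly z ^ 2).map Complex.ofRealHom * R) :
    ∃ a : ℂ × ℂ, a ≠ 0 ∧ ∃ ζ w', w = blockFactor z a ζ w' := by
  have hQ0 : (quadPoly z).map Complex.ofRealHom ≠ 0 := by
    rw [map_quadPoly]; exact mul_ne_zero (X_sub_C_ne_zero _) (X_sub_C_ne_zero _)
  have hz : ((quadPoly z).map Complex.ofRealHom).eval z = 0 := by simp [eval_map_quadPoly]
  obtain ⟨a, ha, w₁, rfl⟩ := exists_eq_linFactor hw (by simp [hN, hz])
  have hn : (sqNorm a : ℂ) ≠ 0 := by exact_mod_cast (sqNorm_pos ha).ne'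
  have hN1 : (hermNorm w₁).eval z = 0 := by
    rw [hermNorm_linFactor, Polynomial.map_mul, map_C, Polynomial.map_pow] at hN
    have h : C (Complex.ofRealHom (sqNorm a ^ 2)) * hermNorm w₁
        = (quadPoly z).map Complex.ofRealHom * R :=
      mul_left_cancel₀ hQ0 (by linear_combination hN)
    have := congrArg (eval z) h
    simpa [hz, hn] using this
  obtain ⟨b, hb, w₂, rfl⟩ := exists_eq_linFactor hw.of_linFactor hN1
  -- If `b` were orthogonal to `a`, it would be a multiple of `J a`, and the product of the two
  -- factors would vanish identically at both `z` and `z̄`.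
  have hab : herm₂ a b ≠ 0 := by
    intro h0
    have hbJ : (sqNorm a : ℂ) • b = det₂ a b • quatJ a := by rw [sqNorm_smul_eq, h0]; simp
    have hb' : b = (det₂ a b / sqNorm a) • quatJ a := by
      rw [div_eq_inv_mul, mul_smul, ← hbJ, smul_smul, inv_mul_cancel₀ hn, one_smul]
    have hzero : ∀ t, (t - z) * (t - conj z) = 0 →
        evalPair t (linFactor z a (linFactor z b w₂)) = 0 := by
      intro t ht
      rw [evalPair_linFactor, evalPair_linFactor, hb', linEval_linEval_smul_quatJ, ht]; simp
    rcases hw with h | h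
    · exact h (hzero z (by simp))
    · exact h (hzero _ (by simp))
  refine ⟨a, ha, det₂ a b / herm₂ a b, ?_⟩
  have hb' : b = (herm₂ a b / sqNorm a) • (a + (det₂ a b / herm₂ a b) • quatJ a) := by
    rw [smul_add, smul_smul, div_mul_div_cancel₀' hab, div_eq_inv_mul, div_eq_inv_mul, mul_smul,
      mul_smul, ← smul_add, ← sqNorm_smul_eq, smul_smul, inv_mul_cancel₀ hn, one_smul]
  refine ⟨(C (Complex.normSq (herm₂ a b / sqNorm a) : ℂ) * w₂.1,
    C (Complex.normSq (herm₂ a b / sqNorm a) : ℂ) * w₂.2), ?_⟩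
  rw [blockFactor, ← linFactor_smul_left, ← hb']

/-! ### Directions attached to the roots of the norm. -/

/-- The datum of a pair of polynomials at a regular point `t` where its norm vanishes: its value at
`t` is a multiple of `y`, its value at `t̄` is orthogonal to `y`. -/
structure IsDatum (w : ℂ[X] × ℂ[X]) (t : ℂ) (y : ℂ × ℂ) : Prop where
  regular : RegularAt w t
  det_eq : det₂ y (evalPair t w) = 0
  herm_eq : herm₂ y (evalPair (conj t) w) = 0

theorem IsDatum.conj_point {w : ℂ[X] × ℂ[X]} {t : ℂ} {y : ℂ × ℂ} (h : IsDatum w t y) :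
    IsDatum w (conj t) (quatJ y) := by
  refine ⟨?_, ?_, ?_⟩
  · have := h.regular
    unfold RegularAt at *
    rw [Complex.conj_conj]
    exact this.symm
  · rw [det₂_quatJ_left, h.herm_eq, neg_zero]
  · rw [herm₂_quatJ, Complex.conj_conj, h.det_eq]

theorem det₂_smul_eq (y y' x : ℂ × ℂ) : det₂ y y' • x = det₂ x y' • y + det₂ y x • y' := by
  ext <;> simp [det₂] <;> ring

/-- At a zero of the norm the matrix with columns `w(t)` and `J w(t̄)` is nonzero with determinant
zero, and the datum spans its image. This line is one of the two ruling coordinates of a point on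
the quadric surface `x₀ = 0`, so points with equal image have parallel data. -/
theorem IsDatum.det_eq_zero {w : ℂ[X] × ℂ[X]} {t s : ℂ} {y y' : ℂ × ℂ} (h : IsDatum w t y)
    (h' : IsDatum w s y') {κ : ℂ} (h1 : evalPair s w = κ • evalPair t w)
    (h2 : evalPair (conj s) w = conj κ • evalPair (conj t) w) : det₂ y y' = 0 := by
  have hκ : κ ≠ 0 := by
    rintro rfl
    rcases h'.regular with h0 | h0
    · exact h0 (by simpa using h1)
    · exact h0 (by simpa using h2)
  have hd := h'.det_eq
  have he := h'.herm_eq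
  rw [h1, det₂_smul, mul_eq_zero, or_iff_right hκ] at hd
  rw [h2, herm₂_smul, mul_eq_zero, or_iff_right (by simpa using hκ)] at he
  have key : ∀ x : ℂ × ℂ, x ≠ 0 → det₂ y x = 0 → det₂ y' x = 0 → det₂ y y' = 0 := by
    intro x hx e1 e2
    have e3 : det₂ x y' = 0 := by
      rw [← neg_eq_zero, ← e2]; simp [det₂]; ring
    have := det₂_smul_eq y y' x
    rw [e1, e3, zero_smul, zero_smul, add_zero] at this
    exact (smul_eq_zero.1 this).resolve_right hx
  rcases h.regular with h0 | h0
  · exact key _ h0 h.det_eq hd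
  · refine key (quatJ (evalPair (conj t) w)) (fun h00 => h0 ?_) ?_ ?_
    · have := congrArg quatJ h00
      rwa [quatJ_quatJ, show quatJ 0 = 0 by simp [quatJ], neg_eq_zero] at this
    · rw [det₂_quatJ_right, h.herm_eq, map_zero]
    · rw [det₂_quatJ_right, he, map_zero]

theorem det₂_linEval (z : ℂ) (a : ℂ × ℂ) (t : ℂ) (x y : ℂ × ℂ) :
    det₂ (linEval z a t x) (linEval z a t y)
      = (sqNorm a : ℂ) ^ 2 * ((t - z) * (t - conj z)) * det₂ x y := by
  rw [ofReal_sqNorm]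
  simp only [linEval, herm₂, det₂]
  ring

theorem herm₂_linEval (z : ℂ) (a : ℂ × ℂ) (t : ℂ) (x y : ℂ × ℂ) :
    herm₂ (linEval z a t x) (linEval z a (conj t) y)
      = (sqNorm a : ℂ) ^ 2 * ((conj t - z) * (conj t - conj z)) * herm₂ x y := by
  rw [ofReal_sqNorm]
  simp only [linEval, herm₂, det₂, map_add, map_sub, map_mul, Complex.conj_conj]
  ring

theorem linEval_ne_zero {z : ℂ} {a : ℂ × ℂ} {t : ℂ} {x : ℂ × ℂ} (ha : a ≠ 0) (h1 : t ≠ z)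
    (h2 : t ≠ conj z) (hx : x ≠ 0) : linEval z a t x ≠ 0 := by
  intro h
  have := linEval_conj_linEval z a t x
  rw [h, show linEval (conj z) a t 0 = 0 by simp [linEval, herm₂, det₂], eq_comm,
    smul_eq_zero] at this
  have hn : (sqNorm a : ℂ) ≠ 0 := by exact_mod_cast (sqNorm_pos ha).ne'
  rcases this with h' | h'
  · simp [hn, sub_eq_zero, h1, h2] at h'
  · exact hx h'

/-- Away from `z` and `z̄` the factor acts by an invertible matrix, which carries the line of the
datum along. -/
theorem IsDatum.linFactor {w : ℂ[X] × ℂ[X]} {t : ℂ} {y : ℂ × ℂ} (h : IsDatum w t y) {z : ℂ}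
    {a : ℂ × ℂ} (ha : a ≠ 0) (h1 : t ≠ z) (h2 : t ≠ conj z) :
    IsDatum (linFactor z a w) t (linEval z a t y) := by
  have h3 : conj t ≠ z := fun h => h2 (by rw [← h, Complex.conj_conj])
  have h4 : conj t ≠ conj z := fun h => h1 ((starRingEnd ℂ).injective h)
  refine ⟨?_, ?_, ?_⟩
  · unfold RegularAt
    rw [evalPair_linFactor, evalPair_linFactor]
    exact h.regular.imp (linEval_ne_zero ha h1 h2) (linEval_ne_zero ha h3 h4)
  · rw [evalPair_linFactor, det₂_linEval, h.det_eq, mul_zero]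
  · rw [evalPair_linFactor, herm₂_linEval, h.herm_eq, mul_zero]

theorem add_smul_quatJ_ne_zero {a : ℂ × ℂ} (ha : a ≠ 0) (ζ : ℂ) : a + ζ • quatJ a ≠ 0 := by
  intro h
  have h1 := sqNorm_add_smul_quatJ a ζ
  rw [h, show sqNorm 0 = 0 by simp [sqNorm]] at h1
  have h2 := Complex.normSq_nonneg ζ
  have h3 := mul_pos (sqNorm_pos ha) (by linarith : (0 : ℝ) < 1 + Complex.normSq ζ)
  linarith

theorem IsDatum.blockFactor {w : ℂ[X] × ℂ[X]} {t : ℂ} {y : ℂ × ℂ} (h : IsDatum w t y) {z : ℂ}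
    {a : ℂ × ℂ} (ha : a ≠ 0) (ζ : ℂ) (h1 : t ≠ z) (h2 : t ≠ conj z) :
    IsDatum (blockFactor z a ζ w) t (blockEval z a ζ t y) :=
  (h.linFactor (add_smul_quatJ_ne_zero ha ζ) h1 h2).linFactor ha h1 h2

/-- At `z` the left factor has image in the line of `a`, and at `z̄` in the line of `J a`. -/
theorem isDatum_blockFactor_self {w : ℂ[X] × ℂ[X]} {z : ℂ} (hz : conj z ≠ z)
    (hw : (hermNorm w).eval z ≠ 0) {a : ℂ × ℂ} (ha : a ≠ 0) (ζ : ℂ) :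
    IsDatum (blockFactor z a ζ w) z a := by
  have hb := add_smul_quatJ_ne_zero ha ζ
  have hab : herm₂ a (a + ζ • quatJ a) = sqNorm a := by
    rw [ofReal_sqNorm]; simp [herm₂, quatJ]; ring
  have hna : (sqNorm a : ℂ) ≠ 0 := by exact_mod_cast (sqNorm_pos ha).ne'
  have hnb : (sqNorm (a + ζ • quatJ a) : ℂ) ≠ 0 := by exact_mod_cast (sqNorm_pos hb).ne'
  set b := a + ζ • quatJ a with hbdef
  have e1 : evalPair z (blockFactor z a ζ w)
      = ((z - conj z) ^ 2 * sqNorm a * herm₂ b (evalPair z w)) • a := by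
    rw [_root_.blockFactor, evalPair_linFactor, evalPair_linFactor, linEval_eq z b, sub_self,
      zero_mul, zero_smul, add_zero, linEval_eq, herm₂_smul, hab, sub_self, zero_mul, zero_smul,
      add_zero]
    congr 1; ring
  have e2 : evalPair (conj z) (blockFactor z a ζ w)
      = ((conj z - z) ^ 2 * sqNorm a * det₂ b (evalPair (conj z) w)) • quatJ a := by
    rw [_root_.blockFactor, evalPair_linFactor, evalPair_linFactor, linEval_eq z b, sub_self,
      zero_mul, zero_smul, zero_add, linEval_eq, det₂_smul, det₂_quatJ_right, hab, sub_self,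
      zero_mul, zero_smul, zero_add, Complex.conj_ofReal]
    congr 1; ring
  refine ⟨?_, ?_, ?_⟩
  -- If both values vanish, then `w(z)` is orthogonal to `b` and `w(z̄)` is parallel to `b`, so the
  -- norm of `w` vanishes at `z`.
  · by_contra hreg
    rw [RegularAt, not_or, not_not, not_not, e1, e2, smul_eq_zero, smul_eq_zero] at hreg
    have hJ : quatJ a ≠ 0 := fun h => ha <| by
      have := congrArg quatJ h
      rwa [quatJ_quatJ, show quatJ 0 = 0 by simp [quatJ], neg_eq_zero] at this
    have h1 := hreg.1.resolve_right ha
    have h2 := hreg.2.resolve_right hJ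
    simp only [mul_eq_zero, pow_eq_zero_iff two_ne_zero, sub_eq_zero, hz, hz.symm, hna,
      false_or] at h1 h2
    refine hw ?_
    rw [eval_hermNorm]
    have h3 : (sqNorm b : ℂ) * herm₂ (evalPair (conj z) w) (evalPair z w)
        = conj (herm₂ b (evalPair (conj z) w)) * herm₂ b (evalPair z w)
          + conj (det₂ b (evalPair (conj z) w)) * det₂ b (evalPair z w) := by
      rw [ofReal_sqNorm]
      simp only [herm₂, det₂, map_add, map_sub, map_mul, Complex.conj_conj]
      ring
    rw [h1, h2, map_zero, mul_zero, zero_mul, add_zero, mul_eq_zero] at h3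
    exact h3.resolve_left hnb
  · rw [e1, det₂_smul, det₂_self, mul_zero]
  · rw [e2, herm₂_smul, herm₂_quatJ_right, det₂_self, map_zero, neg_zero, mul_zero]

/-! ### Parametrization of all maps with positive `p₀`. -/

/-- Parameters `(z, a, ζ, c)` of a curve: three points of the upper half plane, three directions,
three complex numbers and a vector. -/
abbrev CurveParam : Type := (Fin 3 → ℂ) × (Fin 3 → ℂ × ℂ) × (Fin 3 → ℂ) × (ℂ × ℂ)

/-- The pair of polynomials `(p₁ + i p₂, p₃ + i p₄)` of the curve with given parameters. -/
noncomputable def paramPair (d : CurveParam) : ℂ[X] × ℂ[X] :=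
  blockFactor (d.1 0) (d.2.1 0) (d.2.2.1 0) (blockFactor (d.1 1) (d.2.1 1) (d.2.2.1 1)
    (blockFactor (d.1 2) (d.2.1 2) (d.2.2.1 2) (C d.2.2.2.1, C d.2.2.2.2)))

/-- The polynomial `p₀` of the curve with given parameters. -/
noncomputable def paramHeight (d : CurveParam) : ℝ[X] :=
  C (√(sqNorm d.2.2.2)) * ∏ k, (C (sqNorm (d.2.1 k) *
    sqNorm (d.2.1 k + d.2.2.1 k • quatJ (d.2.1 k))) * quadPoly (d.1 k))

theorem hermNorm_blockFactor (z : ℂ) (a : ℂ × ℂ) (ζ : ℂ) (w : ℂ[X] × ℂ[X]) :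
    hermNorm (blockFactor z a ζ w) = ((C (sqNorm a * sqNorm (a + ζ • quatJ a)) *
      quadPoly z) ^ 2).map Complex.ofRealHom * hermNorm w := by
  rw [blockFactor, hermNorm_linFactor, hermNorm_linFactor, ← mul_assoc, ← Polynomial.map_mul]
  congr 2
  simp only [C_mul, C_pow]
  ring

theorem hermNorm_C (c : ℂ × ℂ) :
    hermNorm (C c.1, C c.2) = (C (sqNorm c)).map Complex.ofRealHom := by
  rw [map_C, Complex.ofRealHom_eq_coe, ofReal_sqNorm]
  simp [hermNorm]

theorem hermNorm_paramPair (d : CurveParam) :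
    hermNorm (paramPair d) = (paramHeight d ^ 2).map Complex.ofRealHom := by
  have hc : 0 ≤ sqNorm d.2.2.2 := add_nonneg (Complex.normSq_nonneg _) (Complex.normSq_nonneg _)
  rw [paramPair, hermNorm_blockFactor, hermNorm_blockFactor, hermNorm_blockFactor, hermNorm_C,
    ← Polynomial.map_mul, ← Polynomial.map_mul, ← Polynomial.map_mul]
  congr 1
  rw [paramHeight, mul_pow (C √_), ← C_pow (a := √_), Real.sq_sqrt hc, Fin.prod_univ_three]
  ring

/-- The leading terms cannot cancel: with `m` the larger of the two degrees, the coefficient of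
degree `2m` of the norm is a sum of squared absolute values, not all zero. -/
theorem natDegree_le_of_hermNorm {w : ℂ[X] × ℂ[X]} {n : ℕ}
    (h : (hermNorm w).natDegree ≤ n + n) : w.1.natDegree ≤ n ∧ w.2.natDegree ≤ n := by
  by_contra hcon
  have hm : n < max w.1.natDegree w.2.natDegree := by
    rw [lt_max_iff]; by_contra h'; push Not at h'; exact hcon h'
  set m := max w.1.natDegree w.2.natDegree with hmdef
  have hcoeff : ∀ U : ℂ[X], U.natDegree ≤ m →
      (U * barPoly U).coeff (m + m) = Complex.normSq (U.coeff m) := by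
    intro U hU
    rw [coeff_mul_add_eq_of_natDegree_le hU (natDegree_map_le.trans hU), coeff_map, Complex.mul_conj]
  have h0 : (hermNorm w).coeff (m + m) = 0 := coeff_eq_zero_of_natDegree_lt (by omega)
  rw [hermNorm, coeff_add, hcoeff _ (le_max_left _ _), hcoeff _ (le_max_right _ _)] at h0
  have h1 : Complex.normSq (w.1.coeff m) + Complex.normSq (w.2.coeff m) = 0 := by
    exact_mod_cast h0
  rw [add_eq_zero_iff_of_nonneg (Complex.normSq_nonneg _) (Complex.normSq_nonneg _),
    Complex.normSq_eq_zero, Complex.normSq_eq_zero] at h1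
  have key : ∀ U : ℂ[X], U.natDegree = m → U.coeff m ≠ 0 := by
    intro U hU h2
    rw [← hU, coeff_natDegree, leadingCoeff_eq_zero] at h2
    rw [h2, natDegree_zero] at hU
    omega
  rcases max_choice w.1.natDegree w.2.natDegree with h2 | h2
  · exact key _ h2.symm h1.1
  · exact key _ h2.symm h1.2

theorem natDegree_paramHeight_le (d : CurveParam) : (paramHeight d).natDegree ≤ 6 := by
  rw [paramHeight, Fin.prod_univ_three]
  have h : ∀ k (r : ℝ), (C r * quadPoly (d.1 k)).natDegree ≤ 2 := fun k r =>
    (natDegree_C_mul_le _ _).trans (natDegree_quadPoly _).le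
  refine (natDegree_C_mul_le _ _).trans (natDegree_mul_le.trans ?_)
  exact (add_le_add (natDegree_mul_le.trans (add_le_add (h 0 _) (h 1 _))) (h 2 _))

theorem natDegree_paramPair_le (d : CurveParam) :
    (paramPair d).1.natDegree ≤ 6 ∧ (paramPair d).2.natDegree ≤ 6 := by
  refine natDegree_le_of_hermNorm ?_
  rw [hermNorm_paramPair]
  refine natDegree_map_le.trans (natDegree_pow_le.trans ?_)
  have := natDegree_paramHeight_le d
  omega

theorem natDegree_paramHeight {d : CurveParam} (ha : ∀ k, d.2.1 k ≠ 0) (hc : d.2.2.2 ≠ 0) :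
    (paramHeight d).natDegree = 6 := by
  have hq : ∀ k, quadPoly (d.1 k) ≠ 0 := fun k h => by
    have := natDegree_quadPoly (d.1 k)
    simp [h] at this
  have hr : ∀ k, sqNorm (d.2.1 k) * sqNorm (d.2.1 k + d.2.2.1 k • quatJ (d.2.1 k)) ≠ 0 := fun k =>
    (mul_pos (sqNorm_pos (ha k)) (sqNorm_pos (add_smul_quatJ_ne_zero (ha k) _))).ne'
  rw [paramHeight, natDegree_C_mul (Real.sqrt_pos.2 (sqNorm_pos hc)).ne',
    natDegree_prod _ _ fun k _ => mul_ne_zero (C_ne_zero.2 (hr k)) (hq k)]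
  simp only [natDegree_C_mul (hr _), natDegree_quadPoly]
  simp

theorem eval_quadPoly (z : ℂ) (x : ℝ) : (quadPoly z).eval x = (x - z.re) ^ 2 + z.im ^ 2 := by
  simp [quadPoly, Complex.normSq_apply]; ring

theorem eval_paramHeight_nonneg (d : CurveParam) (x : ℝ) : 0 ≤ (paramHeight d).eval x := by
  have h : ∀ a, 0 ≤ sqNorm a := fun a => add_nonneg (Complex.normSq_nonneg _)
    (Complex.normSq_nonneg _)
  rw [paramHeight, eval_mul, eval_C, eval_prod]
  refine mul_nonneg (Real.sqrt_nonneg _) (Finset.prod_nonneg fun k _ => ?_)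
  rw [eval_mul, eval_C, eval_quadPoly]
  exact mul_nonneg (mul_nonneg (h _) (h _)) (by positivity)

/-- Without real roots, the complex roots come in conjugate pairs, one of each pair in the upper
half plane. -/
theorem exists_eq_quadPoly_mul {P : ℝ[X]} (hP : ∀ x : ℝ, P.eval x ≠ 0) (hd : P.natDegree ≠ 0) :
    ∃ z : ℂ, 0 < z.im ∧ ∃ P' : ℝ[X], P = quadPoly z * P' ∧ P'.natDegree + 2 = P.natDegree ∧
      ∀ x : ℝ, P'.eval x ≠ 0 := by
  have key : ∃ z : ℂ, 0 < z.im ∧ aeval z P = 0 := by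
    obtain ⟨z, hz⟩ := IsAlgClosed.exists_aeval_eq_zero ℂ P
      (fun h => hd (natDegree_eq_zero_iff_degree_le_zero.2 h.le))
    rcases lt_trichotomy z.im 0 with h | h | h
    · exact ⟨conj z, by simpa using h, by rw [aeval_conj, hz, map_zero]⟩
    · refine absurd ?_ (hP z.re)
      have hz' : z = (algebraMap ℝ ℂ) z.re := Complex.ext rfl (by simpa using h)
      rw [hz', aeval_algebraMap_apply] at hz
      simpa using hz
    · exact ⟨z, h, hz⟩
  obtain ⟨z, hz, h0⟩ := key
  obtain ⟨P', hP'⟩ := quadratic_dvd_of_aeval_eq_zero_im_ne_zero P h0 hz.ne'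
  rw [← Complex.normSq_eq_norm_sq] at hP'
  have hP'' : P = quadPoly z * P' := hP'
  have hP0 : P' ≠ 0 := by rintro rfl; simp [hP''] at hd
  refine ⟨z, hz, P', hP'', ?_, fun x hx => hP x (by rw [hP'', eval_mul, hx, mul_zero])⟩
  have hQ : quadPoly z ≠ 0 := fun h => by simp [hP'', h] at hd
  rw [hP'', natDegree_mul hQ hP0, natDegree_quadPoly, add_comm]

theorem RegularAt.of_blockFactor {z : ℂ} {a : ℂ × ℂ} {ζ : ℂ} {w : ℂ[X] × ℂ[X]} {t : ℂ}
    (h : RegularAt (blockFactor z a ζ w) t) : RegularAt w t :=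
  h.of_linFactor.of_linFactor

theorem exists_eq_blockFactor_of_real {w : ℂ[X] × ℂ[X]} {z : ℂ} (hw : RegularAt w z) {R : ℝ[X]}
    (hN : hermNorm w = (quadPoly z ^ 2 * R).map Complex.ofRealHom) :
    ∃ a : ℂ × ℂ, a ≠ 0 ∧ ∃ (ζ : ℂ) (w' : ℂ[X] × ℂ[X]) (r : ℝ), w = blockFactor z a ζ w' ∧
      hermNorm w' = (C r * R).map Complex.ofRealHom := by
  obtain ⟨a, ha, ζ, w', rfl⟩ := exists_eq_blockFactor hw (by rw [hN, Polynomial.map_mul])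
  refine ⟨a, ha, ζ, w', ((sqNorm a * sqNorm (a + ζ • quatJ a)) ^ 2)⁻¹, rfl, ?_⟩
  have hr : (sqNorm a * sqNorm (a + ζ • quatJ a)) ^ 2 ≠ 0 :=
    pow_ne_zero 2 (mul_pos (sqNorm_pos ha) (sqNorm_pos (add_smul_quatJ_ne_zero ha _))).ne'
  set r := (sqNorm a * sqNorm (a + ζ • quatJ a))
  have hQ : (quadPoly z ^ 2 * C (r ^ 2)).map Complex.ofRealHom ≠ 0 := by
    rw [Polynomial.map_ne_zero_iff Complex.ofRealHom.injective]
    refine mul_ne_zero (pow_ne_zero 2 fun h => ?_) (C_ne_zero.2 hr)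
    have := natDegree_quadPoly z
    simp [h] at this
  refine mul_left_cancel₀ hQ ?_
  have hC : C (r ^ 2) * C (r ^ 2)⁻¹ = (1 : ℝ[X]) := by rw [← C_mul, mul_inv_cancel₀ hr, C_1]
  rw [← Polynomial.map_mul, mul_assoc _ (C (r ^ 2)), ← mul_assoc (C (r ^ 2)), hC, one_mul, ← hN,
    hermNorm_blockFactor, mul_pow (C _), ← C_pow (a := _ * _), mul_comm (C (r ^ 2))]

/-- Every regular pair whose norm is the square of a positive polynomial of degree six comes from
parameters. -/
theorem exists_param {P : ℝ[X]} {w : ℂ[X] × ℂ[X]} (hdeg : P.natDegree = 6)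
    (hpos : ∀ x : ℝ, 0 < P.eval x) (hN : hermNorm w = (P ^ 2).map Complex.ofRealHom)
    (hreg : ∀ t : ℂ, (P.map Complex.ofRealHom).eval t = 0 → RegularAt w t) :
    ∃ d : CurveParam, (∀ k, 0 < (d.1 k).im) ∧ d.2.2.2 ≠ 0 ∧ paramPair d = w ∧
      paramHeight d = P := by
  obtain ⟨z₀, hz₀, P₁, hP₁, hd₁, hr₁⟩ := exists_eq_quadPoly_mul (fun x => (hpos x).ne') (by omega)
  obtain ⟨z₁, hz₁, P₂, hP₂, hd₂, hr₂⟩ := exists_eq_quadPoly_mul hr₁ (by omega)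
  obtain ⟨z₂, hz₂, P₃, hP₃, hd₃, hr₃⟩ := exists_eq_quadPoly_mul hr₂ (by omega)
  obtain ⟨r, hr⟩ := natDegree_eq_zero.1 (show P₃.natDegree = 0 by omega)
  -- The roots `z₀, z₁, z₂` may coincide. Regularity is known for `w` at each of them and passes to
  -- the successive quotients, so repeated roots need no separate treatment.
  have hroot : ∀ z : ℂ, quadPoly z ∣ P → RegularAt w z := by
    rintro z ⟨R, rfl⟩
    exact hreg z (by simp [map_quadPoly])
  obtain ⟨a₀, ha₀, ζ₀, w₁, r₁, rfl, hN₁⟩ := exists_eq_blockFactor_of_real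
    (hroot z₀ ⟨_, hP₁⟩) (R := P₁ ^ 2) (by rw [hN, hP₁, mul_pow])
  obtain ⟨a₁, ha₁, ζ₁, w₂, r₂, rfl, hN₂⟩ := exists_eq_blockFactor_of_real
    (hroot z₁ ⟨quadPoly z₀ * P₂, by rw [hP₁, hP₂]; ring⟩).of_blockFactor (R := C r₁ * P₂ ^ 2)
    (by rw [hN₁, hP₂, mul_pow]; congr 1; ring)
  obtain ⟨a₂, ha₂, ζ₂, w₃, r₃, rfl, hN₃⟩ := exists_eq_blockFactor_of_real
    (hroot z₂ ⟨quadPoly z₀ * quadPoly z₁ * P₃, by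
      rw [hP₁, hP₂, hP₃]; ring⟩).of_blockFactor.of_blockFactor (R := C r₂ * (C r₁ * P₃ ^ 2))
    (by rw [hN₂, hP₃, mul_pow]; congr 1; ring)
  have hconst : w₃.1.natDegree ≤ 0 ∧ w₃.2.natDegree ≤ 0 := by
    refine natDegree_le_of_hermNorm ?_
    rw [hN₃, ← hr, ← C_pow, ← C_mul, ← C_mul, ← C_mul, map_C, natDegree_C]
  obtain ⟨c₁, hc₁⟩ := natDegree_eq_zero.1 (Nat.le_zero.1 hconst.1)
  obtain ⟨c₂, hc₂⟩ := natDegree_eq_zero.1 (Nat.le_zero.1 hconst.2)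
  obtain rfl : (C c₁, C c₂) = w₃ := Prod.ext hc₁ hc₂
  let d : CurveParam := (![z₀, z₁, z₂], ![a₀, a₁, a₂], ![ζ₀, ζ₁, ζ₂], (c₁, c₂))
  have hpair : paramPair d = blockFactor z₀ a₀ ζ₀ (blockFactor z₁ a₁ ζ₁ (blockFactor z₂ a₂ ζ₂
    (C c₁, C c₂))) := rfl
  have hH : paramHeight d = P := by
    have h1 : paramHeight d ^ 2 = P ^ 2 := by
      refine Polynomial.map_injective _ Complex.ofRealHom.injective ?_
      rw [← hermNorm_paramPair, hpair, hN]
    -- The norm determines the height only up to sign; positivity of `P` decides.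
    rcases sq_eq_sq_iff_eq_or_eq_neg.1 h1 with h2 | h2
    · exact h2
    · have h3 := eval_paramHeight_nonneg d 0
      rw [h2, eval_neg] at h3
      exact absurd (hpos 0) (by linarith)
  refine ⟨d, ?_, fun h0 => ?_, hpair, hH⟩
  · intro k
    fin_cases k
    · exact hz₀
    · exact hz₁
    · exact hz₂
  · have h3 := hpos 0
    rw [← hH, paramHeight, h0] at h3
    simp [sqNorm] at h3

/-! ### Dictionary between tuples of forms and pairs of polynomials. -/

/-- The dehomogenization of the `i`-th form of a tuple. -/
noncomputable def formPoly {d : ℕ} (p : FormTuple d) (i : Fin 5) : ℝ[X] :=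
  ∑ j : Fin (d + 1), C (p i j) * X ^ (j : ℕ)

/-- The complex polynomials `p₁ + i p₂` and `p₃ + i p₄`. -/
noncomputable def formPair {d : ℕ} (p : FormTuple d) : ℂ[X] × ℂ[X] :=
  ((formPoly p 1).map Complex.ofRealHom + C Complex.I * (formPoly p 2).map Complex.ofRealHom,
    (formPoly p 3).map Complex.ofRealHom + C Complex.I * (formPoly p 4).map Complex.ofRealHom)

/-- The tuple of forms of degree `d` with given `p₀`, `p₁ + i p₂` and `p₃ + i p₄`. -/
noncomputable def toForm (d : ℕ) (P : ℝ[X]) (w : ℂ[X] × ℂ[X]) : FormTuple d :=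
  ![fun j => P.coeff j, fun j => (w.1.coeff j).re, fun j => (w.1.coeff j).im,
    fun j => (w.2.coeff j).re, fun j => (w.2.coeff j).im]

theorem coeff_formPoly {d : ℕ} (p : FormTuple d) (i : Fin 5) (j : Fin (d + 1)) :
    (formPoly p i).coeff j = p i j := by
  simp [formPoly, finsetSum_coeff, coeff_C_mul, coeff_X_pow, Fin.val_inj]

theorem natDegree_formPoly_le {d : ℕ} (p : FormTuple d) (i : Fin 5) :
    (formPoly p i).natDegree ≤ d :=
  natDegree_sum_le_of_forall_le _ _ fun j _ =>
    (natDegree_C_mul_X_pow_le _ _).trans (Nat.lt_succ_iff.1 j.2)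

theorem formPoly_eq {d : ℕ} {p : FormTuple d} {i : Fin 5} {P : ℝ[X]} (hP : P.natDegree ≤ d)
    (h : ∀ j : Fin (d + 1), p i j = P.coeff j) : formPoly p i = P := by
  ext n
  by_cases hn : n < d + 1
  · rw [← h ⟨n, hn⟩]; exact coeff_formPoly p i ⟨n, hn⟩
  · rw [coeff_eq_zero_of_natDegree_lt ((natDegree_formPoly_le p i).trans_lt (by omega)),
      coeff_eq_zero_of_natDegree_lt (by omega)]

theorem formPoly_toForm {d : ℕ} {P : ℝ[X]} {w : ℂ[X] × ℂ[X]} (hP : P.natDegree ≤ d) :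
    formPoly (toForm d P w) 0 = P :=
  formPoly_eq hP fun _ => rfl

theorem coeff_map_formPoly {d : ℕ} (p : FormTuple d) (i : Fin 5) (j : Fin (d + 1)) :
    ((formPoly p i).map Complex.ofRealHom).coeff j = p i j := by
  rw [coeff_map, coeff_formPoly]; rfl

theorem formPair_toForm {d : ℕ} {P : ℝ[X]} {w : ℂ[X] × ℂ[X]} (h1 : w.1.natDegree ≤ d)
    (h2 : w.2.natDegree ≤ d) : formPair (toForm d P w) = w := by
  have key : ∀ (U : ℂ[X]) (i k : Fin 5), U.natDegree ≤ d →
      (∀ j : Fin (d + 1), toForm d P w i j = (U.coeff j).re) →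
      (∀ j : Fin (d + 1), toForm d P w k j = (U.coeff j).im) →
      (formPoly (toForm d P w) i).map Complex.ofRealHom
        + C Complex.I * (formPoly (toForm d P w) k).map Complex.ofRealHom = U := by
    intro U i k hU hi hk
    ext n
    by_cases hn : n < d + 1
    · rw [coeff_add, coeff_C_mul, coeff_map_formPoly _ _ ⟨n, hn⟩, coeff_map_formPoly _ _ ⟨n, hn⟩,
        hi, hk, mul_comm, Complex.re_add_im]
    · have hz : ∀ i, ((formPoly (toForm d P w) i).map Complex.ofRealHom).coeff n = 0 := fun i =>
        coeff_eq_zero_of_natDegree_lt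
          ((natDegree_map_le.trans (natDegree_formPoly_le _ i)).trans_lt (by omega))
      rw [coeff_add, coeff_C_mul, hz, hz, coeff_eq_zero_of_natDegree_lt (by omega : U.natDegree < n)]
      simp
  exact Prod.ext (key w.1 1 2 h1 (fun _ => rfl) fun _ => rfl)
    (key w.2 3 4 h2 (fun _ => rfl) fun _ => rfl)

theorem toForm_formPair {d : ℕ} (p : FormTuple d) : toForm d (formPoly p 0) (formPair p) = p := by
  funext i j
  have h : ∀ i k, (((formPoly p i).map Complex.ofRealHom
      + C Complex.I * (formPoly p k).map Complex.ofRealHom).coeff j) = p i j + p k j * Complex.I := by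
    intro i k
    rw [coeff_add, coeff_C_mul, coeff_map_formPoly, coeff_map_formPoly, mul_comm]
  fin_cases i
  · exact coeff_formPoly p 0 j
  · change (_ : ℂ).re = _
    rw [formPair, h]; simp
  · change (_ : ℂ).im = _
    rw [formPair, h]; simp
  · change (_ : ℂ).re = _
    rw [formPair, h]; simp
  · change (_ : ℂ).im = _
    rw [formPair, h]; simp

theorem evalTuple_affine {d : ℕ} (p : FormTuple d) (t : ℂ) (i : Fin 5) :
    evalTuple ℂ p ![t, 1] i = ((formPoly p i).map Complex.ofRealHom).eval t := by
  simp [evalTuple, formPoly, Polynomial.map_sum, eval_finsetSum]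

theorem evalTuple_real_affine {d : ℕ} (p : FormTuple d) (t : ℝ) (i : Fin 5) :
    evalTuple ℝ p ![t, 1] i = (formPoly p i).eval t := by
  simp [evalTuple, formPoly, eval_finsetSum]

theorem evalTuple_infinity {d : ℕ} (K : Type*) [Field K] [Algebra ℝ K] (p : FormTuple d)
    (i : Fin 5) : evalTuple K p ![1, 0] i = algebraMap ℝ K (p i (Fin.last d)) := by
  rw [evalTuple, Finset.sum_eq_single (Fin.last d)]
  · simp
  · intro j _ hj
    have : (j : ℕ) < d := lt_of_le_of_ne (Nat.lt_succ_iff.1 j.2) fun h => hj (Fin.ext h)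
    simp [Nat.sub_ne_zero_of_lt this]
  · simp

theorem eq_smul_affine_or_infinity {K : Type*} [Field K] (z : Fin 2 → K) :
    (z 1 ≠ 0 ∧ z = z 1 • ![z 0 / z 1, 1]) ∨ z = z 0 • ![1, 0] := by
  by_cases h : z 1 = 0
  · right; ext i; fin_cases i <;> simp [h]
  · left; refine ⟨h, ?_⟩; ext i; fin_cases i
    · simp [mul_div_cancel₀ _ h]
    · simp

theorem hermNorm_formPair {d : ℕ} (p : FormTuple d) :
    hermNorm (formPair p) = (formPoly p 1 ^ 2 + formPoly p 2 ^ 2 + formPoly p 3 ^ 2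
      + formPoly p 4 ^ 2).map Complex.ofRealHom := by
  have hb : ∀ P : ℝ[X], barPoly (P.map Complex.ofRealHom) = P.map Complex.ofRealHom := by
    intro P
    rw [barPoly, Polynomial.map_map]
    congr 1
    exact RingHom.ext fun x => Complex.conj_ofReal x
  have hI : (C Complex.I : ℂ[X]) * C Complex.I = -1 := by
    rw [← C_mul, Complex.I_mul_I, C_neg, C_1]
  simp only [hermNorm, formPair, barPoly, Polynomial.map_add, Polynomial.map_mul, map_C,
    Complex.conj_I, C_neg, Polynomial.map_pow] at hb ⊢
  simp only [hb]
  linear_combination (-(map Complex.ofRealHom (formPoly p 2)) ^ 2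
    - (map Complex.ofRealHom (formPoly p 4)) ^ 2) * hI

theorem liesInSphere_iff {d : ℕ} (p : FormTuple d) :
    LiesInSphere p ↔ hermNorm (formPair p) = (formPoly p 0 ^ 2).map Complex.ofRealHom := by
  rw [hermNorm_formPair, (Polynomial.map_injective _ Complex.ofRealHom.injective).eq_iff]
  constructor
  · intro h
    refine Polynomial.funext fun t => ?_
    have := h ![t, 1]
    simpa only [evalTuple_real_affine, eval_add, eval_pow] using this
  · intro h z
    have key : ∀ (c : ℝ) (y : Fin 2 → ℝ), (evalTuple ℝ p y 1 ^ 2 + evalTuple ℝ p y 2 ^ 2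
        + evalTuple ℝ p y 3 ^ 2 + evalTuple ℝ p y 4 ^ 2 = evalTuple ℝ p y 0 ^ 2) →
        evalTuple ℝ p (c • y) 1 ^ 2 + evalTuple ℝ p (c • y) 2 ^ 2 + evalTuple ℝ p (c • y) 3 ^ 2
          + evalTuple ℝ p (c • y) 4 ^ 2 = evalTuple ℝ p (c • y) 0 ^ 2 := by
      intro c y hy
      simp only [evalTuple_smul_point, Pi.smul_apply, smul_eq_mul]
      linear_combination (c ^ d) ^ 2 * hy
    rcases eq_smul_affine_or_infinity z with ⟨-, hz⟩ | hz
    · rw [hz]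
      refine key _ _ ?_
      have := congrArg (eval (z 0 / z 1)) h
      simpa only [evalTuple_real_affine, eval_add, eval_pow] using this
    · rw [hz]
      refine key _ _ ?_
      -- The equation at infinity is the comparison of coefficients of degree `2d`.
      have hc : ∀ i, (formPoly p i ^ 2).coeff (d + d) = p i (Fin.last d) ^ 2 := by
        intro i
        rw [sq, coeff_mul_add_eq_of_natDegree_le (natDegree_formPoly_le p i)
          (natDegree_formPoly_le p i), ← sq]
        exact congrArg (· ^ 2) (coeff_formPoly p i (Fin.last d))
      have := congrArg (fun q => coeff q (d + d)) h
      simpa only [evalTuple_infinity, coeff_add, hc, Algebra.algebraMap_self_apply] using this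

theorem evalPair_formPair {d : ℕ} (p : FormTuple d) (t : ℂ) :
    evalPair t (formPair p) = (evalTuple ℂ p ![t, 1] 1 + Complex.I * evalTuple ℂ p ![t, 1] 2,
      evalTuple ℂ p ![t, 1] 3 + Complex.I * evalTuple ℂ p ![t, 1] 4) := by
  simp only [evalPair, formPair, evalTuple_affine, eval_add, eval_mul, eval_C]

theorem evalPair_conj_formPair {d : ℕ} (p : FormTuple d) (t : ℂ) :
    evalPair (conj t) (formPair p)
      = (conj (evalTuple ℂ p ![t, 1] 1 - Complex.I * evalTuple ℂ p ![t, 1] 2),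
        conj (evalTuple ℂ p ![t, 1] 3 - Complex.I * evalTuple ℂ p ![t, 1] 4)) := by
  have h : ∀ i, evalTuple ℂ p ![conj t, 1] i = conj (evalTuple ℂ p ![t, 1] i) := by
    intro i
    simp [evalTuple, map_sum]
  simp only [evalPair_formPair, h, map_sub, map_mul, Complex.conj_I, neg_mul, sub_neg_eq_add]

theorem evalPair_eq_smul {d : ℕ} {p : FormTuple d} {s t κ : ℂ}
    (h : evalTuple ℂ p ![s, 1] = κ • evalTuple ℂ p ![t, 1]) :
    evalPair s (formPair p) = κ • evalPair t (formPair p) ∧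
      evalPair (conj s) (formPair p) = conj κ • evalPair (conj t) (formPair p) := by
  constructor
  · rw [evalPair_formPair, evalPair_formPair, h]
    ext <;> simp <;> ring
  · rw [evalPair_conj_formPair, evalPair_conj_formPair, h]
    ext <;> simp <;> ring

/-- The values of the pair at `t` and `t̄` give `p₁ ± i p₂` and `p₃ ± i p₄` at `t`, hence all of
`p₁, …, p₄`. -/
theorem regularAt_formPair_iff {d : ℕ} {p : FormTuple d} {t : ℂ}
    (h0 : evalTuple ℂ p ![t, 1] 0 = 0) :
    RegularAt (formPair p) t ↔ evalTuple ℂ p ![t, 1] ≠ 0 := by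
  rw [RegularAt, evalPair_formPair, evalPair_conj_formPair, ← not_iff_not, not_or, not_not, not_not,
    not_not]
  generalize evalTuple ℂ p ![t, 1] = v at *
  have hI := Complex.I_mul_I
  have key : ∀ a b : ℂ, a + Complex.I * b = 0 → conj (a - Complex.I * b) = 0 → a = 0 ∧ b = 0 := by
    intro a b h1 h2
    rw [map_eq_zero] at h2
    constructor
    · linear_combination (h1 + h2) / 2
    · linear_combination (-Complex.I) * (h1 - h2) / 2 + b * hI
  constructor
  · rintro ⟨h1, h2⟩
    rw [Prod.mk_eq_zero] at h1 h2
    have h3 := key _ _ h1.1 h2.1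
    have h4 := key _ _ h1.2 h2.2
    ext i
    fin_cases i
    · exact h0
    · exact h3.1
    · exact h3.2
    · exact h4.1
    · exact h4.2
  · rintro rfl
    simp

theorem noCommonRoot_of_regularAt {d : ℕ} {p : FormTuple d} (hlead : p 0 (Fin.last d) ≠ 0)
    (h : ∀ t, ((formPoly p 0).map Complex.ofRealHom).eval t = 0 → RegularAt (formPair p) t) :
    NoCommonRoot p := by
  intro z hz h0
  rcases eq_smul_affine_or_infinity z with ⟨hz1, hz'⟩ | hz'
  · rw [hz', evalTuple_smul_point, smul_eq_zero, or_iff_right (pow_ne_zero _ hz1)] at h0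
    have h1 := congrFun h0 0
    exact (regularAt_formPair_iff h1).1 (h _ (by rwa [evalTuple_affine] at h1)) h0
  · have hz0 : z 0 ≠ 0 := fun h0 => hz (by rw [hz', h0, zero_smul])
    rw [hz', evalTuple_smul_point, smul_eq_zero, or_iff_right (pow_ne_zero _ hz0)] at h0
    have h1 := congrFun h0 0
    rw [evalTuple_infinity] at h1
    exact hlead (by simpa using h1)

theorem NoCommonRoot.regularAt {d : ℕ} {p : FormTuple d} (hp : NoCommonRoot p) {t : ℂ}
    (ht : ((formPoly p 0).map Complex.ofRealHom).eval t = 0) : RegularAt (formPair p) t := by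
  rw [← evalTuple_affine] at ht
  exact (regularAt_formPair_iff ht).2 (hp _ fun h => one_ne_zero (congrFun h 1))

/-- At a real zero of `p₀` the sum of the other four squares vanishes, so the zero would be common.
Applied at infinity this yields the exact degree of `p₀`. -/
theorem evalTuple_zero_ne_zero {d : ℕ} {p : FormTuple d} (hp : NoCommonRoot p)
    (hs : LiesInSphere p) {z : Fin 2 → ℝ} (hz : z ≠ 0) : evalTuple ℝ p z 0 ≠ 0 := by
  intro h0
  have h := hs z
  rw [h0] at h
  have hall : evalTuple ℝ p z = 0 := by
    ext i
    have h1 := sq_nonneg (evalTuple ℝ p z 1)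
    have h2 := sq_nonneg (evalTuple ℝ p z 2)
    have h3 := sq_nonneg (evalTuple ℝ p z 3)
    have h4 := sq_nonneg (evalTuple ℝ p z 4)
    fin_cases i
    · exact h0
    · exact sq_eq_zero_iff.1 (show evalTuple ℝ p z 1 ^ 2 = 0 by linarith)
    · exact sq_eq_zero_iff.1 (show evalTuple ℝ p z 2 ^ 2 = 0 by linarith)
    · exact sq_eq_zero_iff.1 (show evalTuple ℝ p z 3 ^ 2 = 0 by linarith)
    · exact sq_eq_zero_iff.1 (show evalTuple ℝ p z 4 ^ 2 = 0 by linarith)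
  have hc : evalTuple ℂ p (fun i => (z i : ℂ)) = 0 := by
    ext i
    have : evalTuple ℂ p (fun i => (z i : ℂ)) i = ((evalTuple ℝ p z i : ℝ) : ℂ) := by
      simp [evalTuple]
    rw [this, hall]
    simp
  refine hp _ (fun h => hz ?_) hc
  ext i
  simpa using congrFun h i

theorem natDegree_formPoly_zero {d : ℕ} {p : FormTuple d} (hp : NoCommonRoot p)
    (hs : LiesInSphere p) : (formPoly p 0).natDegree = d := by
  refine le_antisymm (natDegree_formPoly_le p 0) (le_natDegree_of_ne_zero ?_)
  have h := evalTuple_zero_ne_zero hp hs (z := ![1, 0]) fun h => one_ne_zero (congrFun h 0)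
  rw [evalTuple_infinity] at h
  rw [show (formPoly p 0).coeff d = p 0 (Fin.last d) from coeff_formPoly p 0 (Fin.last d)]
  exact h

theorem eval_formPoly_zero_ne_zero {d : ℕ} {p : FormTuple d} (hp : NoCommonRoot p)
    (hs : LiesInSphere p) (x : ℝ) : (formPoly p 0).eval x ≠ 0 := by
  rw [← evalTuple_real_affine]
  exact evalTuple_zero_ne_zero hp hs fun h => one_ne_zero (congrFun h 1)

theorem formPoly_zero_pos_or_neg {d : ℕ} {p : FormTuple d} (hp : NoCommonRoot p)
    (hs : LiesInSphere p) :
    (∀ x : ℝ, 0 < (formPoly p 0).eval x) ∨ ∀ x : ℝ, (formPoly p 0).eval x < 0 := by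
  by_contra! h
  obtain ⟨⟨x, hx⟩, y, hy⟩ := h
  obtain ⟨t, ht⟩ := mem_range_of_exists_le_of_exists_ge (formPoly p 0).continuous ⟨x, hx⟩ ⟨y, hy⟩
  exact eval_formPoly_zero_ne_zero hp hs t ht

/-! ### Birationality from a separated root of `p₀`. -/

/-- The regular map is birational onto its image if some simple root of `p₀` has an image different
from the images of all other roots of `p₀`. -/
theorem isBirationalOntoImage_of_separated_root {n : ℕ} {p : FormTuple (n + 2)}
    (hp : NoCommonRoot p) (hdeg : (formPoly p 0).natDegree = n + 2) {z : ℂ}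
    (hz : ((formPoly p 0).map Complex.ofRealHom).eval z = 0)
    (hz' : ((formPoly p 0).map Complex.ofRealHom).derivative.eval z ≠ 0)
    (hsep : ∀ x, ((formPoly p 0).map Complex.ofRealHom).eval x = 0 → x ≠ z → ∀ κ : ℂ,
      evalTuple ℂ p ![x, 1] ≠ κ • evalTuple ℂ p ![z, 1])
    (hroot : ∃ x, ((formPoly p 0).map Complex.ofRealHom).eval x = 0 ∧ x ≠ z) :
    IsBirationalOntoImage p hp := by
  have hne : ∀ t : ℂ, (![t, 1] : Fin 2 → ℂ) ≠ 0 := fun t h => one_ne_zero (congrFun h 1)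
  have hne' : (![1, 0] : Fin 2 → ℂ) ≠ 0 := fun h => one_ne_zero (congrFun h 0)
  have hev : ∀ t, (fun i => ((formPoly p i).map Complex.ofRealHom).eval t)
      = evalTuple ℂ p ![t, 1] := fun t => funext fun i => (evalTuple_affine p t i).symm
  have hlead : ∀ i, ((formPoly p i).map Complex.ofRealHom).coeff (n + 2)
      = evalTuple ℂ p ![1, 0] i := fun i => by
    rw [evalTuple_infinity]; exact coeff_map_formPoly p i (Fin.last _)
  obtain ⟨h1, h2⟩ := finite_collisions_of_separated_root
    (Q := fun i => (formPoly p i).map Complex.ofRealHom) (n := n) (i₀ := 0)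
    (by rw [natDegree_map_eq_of_injective Complex.ofRealHom.injective, hdeg])
    (fun i => natDegree_map_le.trans (natDegree_formPoly_le p i)) hz hz'
    (by rw [hev]; exact hp _ (hne z))
    (by simpa only [hev] using hsep) hroot
  have hcover : ∀ x : ℙ ℂ (Fin 2 → ℂ), (∃ t, x = Projectivization.mk ℂ ![t, 1] (hne t)) ∨
      x = Projectivization.mk ℂ ![1, 0] hne' := by
    intro x
    induction x using Projectivization.ind with
    | h v hv =>
      rcases eq_smul_affine_or_infinity v with ⟨-, h⟩ | h
      · exact Or.inl ⟨_, (Projectivization.mk_eq_mk_iff' ..).2 ⟨_, h.symm⟩⟩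
      · exact Or.inr ((Projectivization.mk_eq_mk_iff' ..).2 ⟨_, h.symm⟩)
  -- Affine points colliding with affine points, affine points colliding with infinity, and infinity
  -- itself cover all multiple points.
  refine (((h1.union h2).image fun t => Projectivization.mk ℂ ![t, 1] (hne t)).insert
    (Projectivization.mk ℂ ![1, 0] hne')).subset ?_
  rintro x ⟨y, hyx, hxy⟩
  rcases hcover x with ⟨t, rfl⟩ | rfl
  · refine Set.mem_insert_of_mem _ ⟨t, ?_, rfl⟩
    rcases hcover y with ⟨s, rfl⟩ | rfl
    · left
      rw [complexMap_mk, complexMap_mk, Projectivization.mk_eq_mk_iff'] at hxy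
      obtain ⟨κ, hκ⟩ := hxy
      refine ⟨s, fun h => hyx (by rw [h]), κ, fun i => ?_⟩
      rw [← evalTuple_affine, ← evalTuple_affine, ← hκ]
      rfl
    · right
      rw [complexMap_mk, complexMap_mk, eq_comm, Projectivization.mk_eq_mk_iff'] at hxy
      obtain ⟨κ, hκ⟩ := hxy
      refine ⟨κ, fun i => ?_⟩
      rw [hlead, ← evalTuple_affine, ← hκ]
      rfl
  · exact Set.mem_insert _ _

/-! ### Generic parameters give birational maps. -/

/-- Generic parameters: the points `z` are distinct, and the direction of the curve at `z₀` is
neither parallel nor orthogonal to the directions at `z₁` and `z₂`. -/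
structure IsGenericParam (d : CurveParam) : Prop where
  im_pos : ∀ k, 0 < (d.1 k).im
  ne₁ : d.1 1 ≠ d.1 0
  ne₂ : d.1 2 ≠ d.1 0
  ne₁₂ : d.1 2 ≠ d.1 1
  vec_ne : d.2.2.2 ≠ 0
  det₁ : det₂ (d.2.1 0) (blockEval (d.1 0) (d.2.1 0) (d.2.2.1 0) (d.1 1) (d.2.1 1)) ≠ 0
  herm₁ : herm₂ (d.2.1 0) (blockEval (d.1 0) (d.2.1 0) (d.2.2.1 0) (d.1 1) (d.2.1 1)) ≠ 0
  det₂ : det₂ (d.2.1 0) (blockEval (d.1 0) (d.2.1 0) (d.2.2.1 0) (d.1 2)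
    (blockEval (d.1 1) (d.2.1 1) (d.2.2.1 1) (d.1 2) (d.2.1 2))) ≠ 0
  herm₂ : herm₂ (d.2.1 0) (blockEval (d.1 0) (d.2.1 0) (d.2.2.1 0) (d.1 2)
    (blockEval (d.1 1) (d.2.1 1) (d.2.2.1 1) (d.1 2) (d.2.1 2))) ≠ 0

theorem linEval_zero (z : ℂ) (a : ℂ × ℂ) (t : ℂ) : linEval z a t 0 = 0 := by
  simp [linEval, herm₂, det₂]

theorem blockEval_zero (z : ℂ) (a : ℂ × ℂ) (ζ t : ℂ) : blockEval z a ζ t 0 = 0 := by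
  rw [blockEval, linEval_zero, linEval_zero]

theorem IsGenericParam.dir_ne_zero {d : CurveParam} (h : IsGenericParam d) (k : Fin 3) :
    d.2.1 k ≠ 0 := by
  fin_cases k
  · intro h0
    refine h.det₁ ?_
    rw [show d.2.1 0 = 0 from h0]
    simp [_root_.det₂]
  · intro h0
    refine h.det₁ ?_
    rw [show d.2.1 1 = 0 from h0, blockEval_zero]
    simp [_root_.det₂]
  · intro h0
    refine h.det₂ ?_
    rw [show d.2.1 2 = 0 from h0, blockEval_zero, blockEval_zero]
    simp [_root_.det₂]

theorem ne_conj_of_im_pos {z t : ℂ} (hz : 0 < z.im) (ht : 0 < t.im) : t ≠ conj z := by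
  intro h
  have := congrArg Complex.im h
  rw [Complex.conj_im] at this
  linarith

theorem map_paramHeight (d : CurveParam) : ∃ r : ℂ, (paramHeight d).map Complex.ofRealHom
    = C r * ∏ k, ((X - C (d.1 k)) * (X - C (conj (d.1 k)))) := by
  let r : Fin 3 → ℂ := fun k => Complex.ofRealHom
    (sqNorm (d.2.1 k) * sqNorm (d.2.1 k + d.2.2.1 k • quatJ (d.2.1 k)))
  refine ⟨Complex.ofRealHom √(sqNorm d.2.2.2) * r 0 * r 1 * r 2, ?_⟩
  simp only [paramHeight, Fin.prod_univ_three, Polynomial.map_mul, map_quadPoly, map_C,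
    map_mul, r]
  ring

theorem eval_map_paramHeight_eq_zero_iff {d : CurveParam} (ha : ∀ k, d.2.1 k ≠ 0)
    (hc : d.2.2.2 ≠ 0) (t : ℂ) : ((paramHeight d).map Complex.ofRealHom).eval t = 0 ↔
      ∃ k, t = d.1 k ∨ t = conj (d.1 k) := by
  obtain ⟨r, hr⟩ := map_paramHeight d
  have hr0 : r ≠ 0 := by
    rintro rfl
    rw [C_0, zero_mul, Polynomial.map_eq_zero_iff Complex.ofRealHom.injective] at hr
    have := natDegree_paramHeight ha hc
    simp [hr] at this
  rw [hr]
  simp [eval_prod, Finset.prod_eq_zero_iff, hr0, sub_eq_zero]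

theorem eval_hermNorm_blockFactor_ne_zero {z : ℂ} {a : ℂ × ℂ} (ha : a ≠ 0) (ζ : ℂ)
    {w : ℂ[X] × ℂ[X]} {t : ℂ} (h1 : t ≠ z) (h2 : t ≠ conj z) (hw : (hermNorm w).eval t ≠ 0) :
    (hermNorm (blockFactor z a ζ w)).eval t ≠ 0 := by
  have hr : ((sqNorm a * sqNorm (a + ζ • quatJ a) : ℝ) : ℂ) ≠ 0 := Complex.ofReal_ne_zero.2
    (mul_pos (sqNorm_pos ha) (sqNorm_pos (add_smul_quatJ_ne_zero ha ζ))).ne'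
  rw [hermNorm_blockFactor, eval_mul, Polynomial.map_pow, Polynomial.map_mul, map_C, eval_pow,
    eval_mul, eval_C, eval_map_quadPoly]
  exact mul_ne_zero (pow_ne_zero 2 (mul_ne_zero hr
    (mul_ne_zero (sub_ne_zero.2 h1) (sub_ne_zero.2 h2)))) hw

theorem eval_hermNorm_C_ne_zero {c : ℂ × ℂ} (hc : c ≠ 0) (t : ℂ) :
    (hermNorm (C c.1, C c.2)).eval t ≠ 0 := by
  rw [hermNorm_C, map_C, eval_C]
  exact Complex.ofReal_ne_zero.2 (sqNorm_pos hc).ne'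

namespace IsGenericParam

theorem isDatum₀ {d : CurveParam} (h : IsGenericParam d) : IsDatum (paramPair d) (d.1 0) (d.2.1 0) := by
  refine isDatum_blockFactor_self (ne_conj_of_im_pos (h.im_pos 0) (h.im_pos 0)).symm ?_
    (h.dir_ne_zero 0) _
  refine eval_hermNorm_blockFactor_ne_zero (h.dir_ne_zero 1) _ h.ne₁.symm
    (ne_conj_of_im_pos (h.im_pos 1) (h.im_pos 0)) ?_
  exact eval_hermNorm_blockFactor_ne_zero (h.dir_ne_zero 2) _ h.ne₂.symm
    (ne_conj_of_im_pos (h.im_pos 2) (h.im_pos 0)) (eval_hermNorm_C_ne_zero h.vec_ne _)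

theorem isDatum₁ {d : CurveParam} (h : IsGenericParam d) : IsDatum (paramPair d) (d.1 1)
    (blockEval (d.1 0) (d.2.1 0) (d.2.2.1 0) (d.1 1) (d.2.1 1)) := by
  refine IsDatum.blockFactor ?_ (h.dir_ne_zero 0) _ h.ne₁
    (ne_conj_of_im_pos (h.im_pos 0) (h.im_pos 1))
  refine isDatum_blockFactor_self (ne_conj_of_im_pos (h.im_pos 1) (h.im_pos 1)).symm ?_
    (h.dir_ne_zero 1) _
  exact eval_hermNorm_blockFactor_ne_zero (h.dir_ne_zero 2) _ h.ne₁₂.symm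
    (ne_conj_of_im_pos (h.im_pos 2) (h.im_pos 1)) (eval_hermNorm_C_ne_zero h.vec_ne _)

/-- The direction `a₂` is the datum of the innermost block; the two outer blocks, invertible at
`z₂`, transport it. -/
theorem isDatum₂ {d : CurveParam} (h : IsGenericParam d) : IsDatum (paramPair d) (d.1 2)
    (blockEval (d.1 0) (d.2.1 0) (d.2.2.1 0) (d.1 2)
      (blockEval (d.1 1) (d.2.1 1) (d.2.2.1 1) (d.1 2) (d.2.1 2))) := by
  refine IsDatum.blockFactor (IsDatum.blockFactor ?_ (h.dir_ne_zero 1) _ h.ne₁₂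
    (ne_conj_of_im_pos (h.im_pos 1) (h.im_pos 2))) (h.dir_ne_zero 0) _ h.ne₂
    (ne_conj_of_im_pos (h.im_pos 0) (h.im_pos 2))
  exact isDatum_blockFactor_self (ne_conj_of_im_pos (h.im_pos 2) (h.im_pos 2)).symm
    (eval_hermNorm_C_ne_zero h.vec_ne _) (h.dir_ne_zero 2) _

/-- At each root of `p₀` there is a datum, and it is not parallel to the datum at `z₀` unless the
root is `z₀`. -/
theorem exists_isDatum {d : CurveParam} (h : IsGenericParam d) {t : ℂ}
    (ht : ((paramHeight d).map Complex.ofRealHom).eval t = 0) :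
    ∃ y, IsDatum (paramPair d) t y ∧ (t ≠ d.1 0 → _root_.det₂ (d.2.1 0) y ≠ 0) := by
  -- The datum at `z̄ₖ` is `J` of the datum at `zₖ`; this is why genericity also demands nonzero
  -- Hermitian products.
  have hJ : ∀ y, _root_.herm₂ (d.2.1 0) y ≠ 0 → _root_.det₂ (d.2.1 0) (quatJ y) ≠ 0 := by
    intro y hy
    rw [det₂_quatJ_right]
    exact (_root_.map_ne_zero _).2 hy
  obtain ⟨k, rfl | rfl⟩ := (eval_map_paramHeight_eq_zero_iff h.dir_ne_zero h.vec_ne t).1 ht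
  · fin_cases k
    · exact ⟨_, h.isDatum₀, fun h => absurd rfl h⟩
    · exact ⟨_, h.isDatum₁, fun _ => h.det₁⟩
    · exact ⟨_, h.isDatum₂, fun _ => h.det₂⟩
  · fin_cases k
    · refine ⟨_, h.isDatum₀.conj_point, fun _ => hJ _ ?_⟩
      rw [herm₂_self]
      exact Complex.ofReal_ne_zero.2 (sqNorm_pos (h.dir_ne_zero 0)).ne'
    · exact ⟨_, h.isDatum₁.conj_point, fun _ => hJ _ h.herm₁⟩
    · exact ⟨_, h.isDatum₂.conj_point, fun _ => hJ _ h.herm₂⟩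

theorem eval_derivative_ne_zero {d : CurveParam} (h : IsGenericParam d) :
    ((paramHeight d).map Complex.ofRealHom).derivative.eval (d.1 0) ≠ 0 := by
  obtain ⟨r, hr⟩ := map_paramHeight d
  have hr0 : r ≠ 0 := by
    rintro rfl
    rw [C_0, zero_mul, Polynomial.map_eq_zero_iff Complex.ofRealHom.injective] at hr
    have := natDegree_paramHeight h.dir_ne_zero h.vec_ne
    simp [hr] at this
  have hc : ∀ k l, d.1 k - conj (d.1 l) ≠ 0 := fun k l =>
    sub_ne_zero.2 (ne_conj_of_im_pos (h.im_pos l) (h.im_pos k))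
  rw [hr, Fin.prod_univ_three]
  simp [hr0, hc, sub_ne_zero, h.ne₁.symm, h.ne₂.symm]

end IsGenericParam

/-- The tuple of forms with given parameters. -/
noncomputable def paramForm (d : CurveParam) : FormTuple 6 := toForm 6 (paramHeight d) (paramPair d)

theorem formPoly_paramForm (d : CurveParam) : formPoly (paramForm d) 0 = paramHeight d :=
  formPoly_toForm (natDegree_paramHeight_le d)

theorem formPair_paramForm (d : CurveParam) : formPair (paramForm d) = paramPair d :=
  formPair_toForm (natDegree_paramPair_le d).1 (natDegree_paramPair_le d).2

theorem liesInSphere_paramForm (d : CurveParam) : LiesInSphere (paramForm d) := by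
  rw [liesInSphere_iff, formPair_paramForm, formPoly_paramForm, hermNorm_paramPair]

theorem IsGenericParam.noCommonRoot {d : CurveParam} (h : IsGenericParam d) :
    NoCommonRoot (paramForm d) := by
  refine noCommonRoot_of_regularAt ?_ fun t ht => ?_
  · rw [← coeff_formPoly (paramForm d), formPoly_paramForm, Fin.val_last]
    have h1 := natDegree_paramHeight h.dir_ne_zero h.vec_ne
    have h2 : paramHeight d ≠ 0 := fun h0 => by simp [h0] at h1
    rw [← h1]
    exact leadingCoeff_ne_zero.2 h2
  · rw [formPoly_paramForm] at ht
    rw [formPair_paramForm]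
    obtain ⟨y, hy, -⟩ := h.exists_isDatum ht
    exact hy.regular

theorem IsGenericParam.isBirational {d : CurveParam} (h : IsGenericParam d) :
    IsBirationalOntoImage (paramForm d) h.noCommonRoot := by
  refine isBirationalOntoImage_of_separated_root (n := 4) h.noCommonRoot
    (by rw [formPoly_paramForm]; exact natDegree_paramHeight h.dir_ne_zero h.vec_ne)
    (z := d.1 0) ?_ ?_ ?_ ⟨d.1 1, ?_, h.ne₁⟩
  · rw [formPoly_paramForm, eval_map_paramHeight_eq_zero_iff h.dir_ne_zero h.vec_ne]
    exact ⟨0, Or.inl rfl⟩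
  · rw [formPoly_paramForm]
    exact h.eval_derivative_ne_zero
  · intro x hx hxz κ hκ
    rw [formPoly_paramForm] at hx
    obtain ⟨y, hy, hdet⟩ := h.exists_isDatum hx
    obtain ⟨h1, h2⟩ := evalPair_eq_smul hκ
    rw [formPair_paramForm] at h1 h2
    exact hdet hxz (h.isDatum₀.det_eq_zero hy h1 h2)
  · rw [formPoly_paramForm, eval_map_paramHeight_eq_zero_iff h.dir_ne_zero h.vec_ne]
    exact ⟨1, Or.inl rfl⟩

/-- Every regular map of degree six to the sphere with `p₀ > 0` comes from parameters. -/
theorem exists_paramForm_eq {p : FormTuple 6} (hp : NoCommonRoot p) (hs : LiesInSphere p)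
    (hpos : ∀ x : ℝ, 0 < (formPoly p 0).eval x) :
    ∃ d : CurveParam, (∀ k, 0 < (d.1 k).im) ∧ d.2.2.2 ≠ 0 ∧ paramForm d = p := by
  obtain ⟨d, h1, h2, h3, h4⟩ := exists_param (natDegree_formPoly_zero hp hs) hpos
    ((liesInSphere_iff p).1 hs) fun t ht => hp.regularAt ht
  exact ⟨d, h1, h2, by rw [paramForm, h3, h4, toForm_formPair]⟩

/-! ### Continuity of the map from parameters to tuples of forms. -/

open Topology Filter

/-- A family of polynomials whose coefficients are continuous. -/
def CoeffContinuous {T R : Type*} [TopologicalSpace T] [TopologicalSpace R] [Semiring R]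
    (f : T → R[X]) : Prop :=
  ∀ j, Continuous fun x => (f x).coeff j

namespace CoeffContinuous

variable {T R : Type*} [TopologicalSpace T] [TopologicalSpace R] [CommRing R]

theorem const (P : R[X]) : CoeffContinuous fun _ : T => P := fun _ => continuous_const

theorem C_comp {r : T → R} (hr : Continuous r) : CoeffContinuous fun x => C (r x) := fun j => by
  simp only [coeff_C]
  split_ifs
  · exact hr
  · exact continuous_const

variable [IsTopologicalRing R] {f g : T → R[X]}

theorem add (hf : CoeffContinuous f) (hg : CoeffContinuous g) :
    CoeffContinuous fun x => f x + g x := fun j => by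
  simp only [coeff_add]; exact (hf j).add (hg j)

theorem sub (hf : CoeffContinuous f) (hg : CoeffContinuous g) :
    CoeffContinuous fun x => f x - g x := fun j => by
  simp only [coeff_sub]; exact (hf j).sub (hg j)

theorem mul (hf : CoeffContinuous f) (hg : CoeffContinuous g) :
    CoeffContinuous fun x => f x * g x := fun j => by
  simp only [coeff_mul]; exact continuous_finsetSum _ fun i _ => (hf i.1).mul (hg i.2)

theorem X_sub_C {r : T → R} (hr : Continuous r) : CoeffContinuous fun x => X - C (r x) :=
  (const X).sub (C_comp hr)

end CoeffContinuous

section Continuity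

variable {T : Type*} [TopologicalSpace T]

theorem Continuous.complex_conj {r : T → ℂ} (hr : Continuous r) :
    Continuous fun x => conj (r x) := Complex.continuous_conj.comp hr

theorem Continuous.quatJ {a : T → ℂ × ℂ} (ha : Continuous a) :
    Continuous fun x => quatJ (a x) :=
  ha.snd.complex_conj.neg.prodMk ha.fst.complex_conj

theorem Continuous.sqNorm {a : T → ℂ × ℂ} (ha : Continuous a) :
    Continuous fun x => sqNorm (a x) :=
  (Complex.continuous_normSq.comp ha.fst).add (Complex.continuous_normSq.comp ha.snd)

theorem Continuous.linEval {z t : T → ℂ} {a y : T → ℂ × ℂ} (hz : Continuous z) (ha : Continuous a)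
    (ht : Continuous t) (hy : Continuous y) :
    Continuous fun x => linEval (z x) (a x) (t x) (y x) := by
  have h1 := hz.complex_conj
  have h2 := ha.fst.complex_conj
  have h3 := ha.snd.complex_conj
  unfold _root_.linEval herm₂ det₂
  fun_prop

theorem CoeffContinuous.linFactor {z : T → ℂ} {a : T → ℂ × ℂ} {w : T → ℂ[X] × ℂ[X]}
    (hz : Continuous z) (ha : Continuous a) (hw : CoeffContinuous (fun x => (w x).1) ∧
      CoeffContinuous fun x => (w x).2) :
    CoeffContinuous (fun x => (linFactor (z x) (a x) (w x)).1) ∧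
      CoeffContinuous fun x => (linFactor (z x) (a x) (w x)).2 := by
  have h1 := C_comp ha.fst
  have h2 := C_comp ha.snd
  have h1' := C_comp ha.fst.complex_conj
  have h2' := C_comp ha.snd.complex_conj
  have hp := (X_sub_C hz.complex_conj).mul ((h1'.mul hw.1).add (h2'.mul hw.2))
  have hq := (X_sub_C hz).mul ((h1.mul hw.2).sub (h2.mul hw.1))
  exact ⟨(hp.mul h1).sub (hq.mul h2'), (hp.mul h2).add (hq.mul h1')⟩

theorem CoeffContinuous.blockFactor {z ζ : T → ℂ} {a : T → ℂ × ℂ} {w : T → ℂ[X] × ℂ[X]}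
    (hz : Continuous z) (ha : Continuous a) (hζ : Continuous ζ)
    (hw : CoeffContinuous (fun x => (w x).1) ∧ CoeffContinuous fun x => (w x).2) :
    CoeffContinuous (fun x => (blockFactor (z x) (a x) (ζ x) (w x)).1) ∧
      CoeffContinuous fun x => (blockFactor (z x) (a x) (ζ x) (w x)).2 :=
  linFactor hz ha (linFactor hz (ha.add (hζ.smul ha.quatJ)) hw)

end Continuity

theorem coeffContinuous_paramPair : CoeffContinuous (fun d => (paramPair d).1) ∧
    CoeffContinuous fun d => (paramPair d).2 := by
  unfold paramPair
  refine CoeffContinuous.blockFactor (by fun_prop) (by fun_prop) (by fun_prop) <|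
    CoeffContinuous.blockFactor (by fun_prop) (by fun_prop) (by fun_prop) <|
    CoeffContinuous.blockFactor (by fun_prop) (by fun_prop) (by fun_prop) ?_
  exact ⟨.C_comp (by fun_prop), .C_comp (by fun_prop)⟩

theorem coeffContinuous_paramHeight : CoeffContinuous paramHeight := by
  have hq : ∀ k, CoeffContinuous fun d : CurveParam => C (sqNorm (d.2.1 k) *
      sqNorm (d.2.1 k + d.2.2.1 k • quatJ (d.2.1 k))) * quadPoly (d.1 k) := by
    intro k
    have ha : Continuous fun d : CurveParam => d.2.1 k := by fun_prop
    have hζ : Continuous fun d : CurveParam => d.2.2.1 k := by fun_prop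
    have hz : Continuous fun d : CurveParam => d.1 k := by fun_prop
    refine (CoeffContinuous.C_comp (ha.sqNorm.mul (ha.add (hζ.smul ha.quatJ)).sqNorm)).mul ?_
    exact ((CoeffContinuous.const _).sub ((CoeffContinuous.C_comp
      (continuous_const.mul (Complex.continuous_re.comp hz))).mul (.const X))).add
      (.C_comp (Complex.continuous_normSq.comp hz))
  unfold paramHeight
  simp only [Fin.prod_univ_three]
  refine CoeffContinuous.mul (.C_comp (Continuous.sqrt (Continuous.sqNorm (by fun_prop))))
    (((hq 0).mul (hq 1)).mul (hq 2))

theorem continuous_paramForm : Continuous paramForm := by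
  refine continuous_pi fun i => continuous_pi fun j => ?_
  obtain ⟨h1, h2⟩ := coeffContinuous_paramPair
  fin_cases i
  · exact coeffContinuous_paramHeight j
  · exact Complex.continuous_re.comp (h1 j)
  · exact Complex.continuous_im.comp (h1 j)
  · exact Complex.continuous_re.comp (h2 j)
  · exact Complex.continuous_im.comp (h2 j)

/-! ### Coordinates on the generic locus and its path-connectedness. -/

/-- The adjugate of `blockEval`. -/
def blockAdj (z : ℂ) (a : ℂ × ℂ) (ζ : ℂ) (t : ℂ) (x : ℂ × ℂ) : ℂ × ℂ :=
  linEval (conj z) (a + ζ • quatJ a) t (linEval (conj z) a t x)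

/-- The determinant of `blockEval`. -/
noncomputable def blockDet (z : ℂ) (a : ℂ × ℂ) (ζ : ℂ) (t : ℂ) : ℂ :=
  ((sqNorm a : ℂ) ^ 2 * ((t - z) * (t - conj z))) *
    ((sqNorm (a + ζ • quatJ a) : ℂ) ^ 2 * ((t - z) * (t - conj z)))

theorem blockEval_smul (z : ℂ) (a : ℂ × ℂ) (ζ t r : ℂ) (x : ℂ × ℂ) :
    blockEval z a ζ t (r • x) = r • blockEval z a ζ t x := by
  rw [blockEval, linEval_smul, linEval_smul, blockEval]

theorem blockAdj_smul (z : ℂ) (a : ℂ × ℂ) (ζ t r : ℂ) (x : ℂ × ℂ) :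
    blockAdj z a ζ t (r • x) = r • blockAdj z a ζ t x := by
  rw [blockAdj, linEval_smul, linEval_smul, blockAdj]

theorem blockEval_blockAdj (z : ℂ) (a : ℂ × ℂ) (ζ t : ℂ) (x : ℂ × ℂ) :
    blockEval z a ζ t (blockAdj z a ζ t x) = blockDet z a ζ t • x := by
  rw [blockEval, blockAdj, linEval_linEval_conj, linEval_smul, linEval_linEval_conj, smul_smul,
    blockDet, mul_comm]

theorem blockAdj_blockEval (z : ℂ) (a : ℂ × ℂ) (ζ t : ℂ) (x : ℂ × ℂ) :
    blockAdj z a ζ t (blockEval z a ζ t x) = blockDet z a ζ t • x := by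
  rw [blockEval, blockAdj, linEval_conj_linEval, linEval_smul, linEval_conj_linEval, smul_smul,
    blockDet]

theorem blockDet_ne_zero {z : ℂ} {a : ℂ × ℂ} (ha : a ≠ 0) (ζ : ℂ) {t : ℂ} (h1 : t ≠ z)
    (h2 : t ≠ conj z) : blockDet z a ζ t ≠ 0 := by
  have hna : (sqNorm a : ℂ) ≠ 0 := Complex.ofReal_ne_zero.2 (sqNorm_pos ha).ne'
  have hnb : (sqNorm (a + ζ • quatJ a) : ℂ) ≠ 0 :=
    Complex.ofReal_ne_zero.2 (sqNorm_pos (add_smul_quatJ_ne_zero ha ζ)).ne'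
  simp [blockDet, hna, hnb, sub_ne_zero, h1, h2]

theorem Continuous.blockAdj {T : Type*} [TopologicalSpace T] {z t ζ : T → ℂ} {a y : T → ℂ × ℂ}
    (hz : Continuous z) (ha : Continuous a) (hζ : Continuous ζ) (ht : Continuous t)
    (hy : Continuous y) : Continuous fun x => blockAdj (z x) (a x) (ζ x) (t x) (y x) :=
  hz.complex_conj.linEval (ha.add (hζ.smul ha.quatJ)) ht (hz.complex_conj.linEval ha ht hy)

/-- A homeomorphism from the complex plane to the upper half plane. -/
noncomputable def upperMap (v : ℂ) : ℂ := ⟨v.re, Real.exp v.im⟩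

theorem continuous_upperMap : Continuous upperMap := by
  have : upperMap = fun v : ℂ => (v.re : ℂ) + (Real.exp v.im : ℝ) * Complex.I := by
    funext v
    exact Complex.ext (by simp [upperMap]) (by simp only [upperMap]; simp [-Complex.ofReal_exp])
  rw [this]
  fun_prop

theorem upperMap_injective : Function.Injective upperMap := fun _ _ h =>
  Complex.ext (by exact congrArg Complex.re h :) (Real.exp_injective (congrArg Complex.im h))

theorem exists_upperMap_eq {z : ℂ} (hz : 0 < z.im) : ∃ v, upperMap v = z :=
  ⟨⟨z.re, Real.log z.im⟩, Complex.ext rfl (Real.exp_log hz)⟩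

/-- Coordinates on the space of generic parameters. -/
abbrev GenericCoord : Type :=
  (ℂ × ℂ × ℂ) × (ℂ × ℂ) × (Fin 3 → ℂ) × (ℂ × ℂ) × (ℂ × ℂ) × (ℂ × ℂ)

/-- The domain of the coordinates on the space of generic parameters. -/
def genericDomain : Set GenericCoord :=
  (Set.univ ×ˢ ({0}ᶜ : Set ℂ) ×ˢ ({0, 1}ᶜ : Set ℂ)) ×ˢ ({0}ᶜ : Set (ℂ × ℂ)) ×ˢ Set.univ ×ˢ
    (({0}ᶜ : Set ℂ) ×ˢ ({0}ᶜ : Set ℂ)) ×ˢ (({0}ᶜ : Set ℂ) ×ˢ ({0}ᶜ : Set ℂ)) ×ˢ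
    ({0}ᶜ : Set (ℂ × ℂ))

theorem isPathConnected_genericDomain : IsPathConnected genericDomain := by
  have hℂ : 1 < Module.rank ℝ ℂ := by rw [Complex.rank_real_complex]; norm_num
  have hℂ2 : 1 < Module.rank ℝ (ℂ × ℂ) := by
    rw [rank_prod']
    exact hℂ.trans_le le_self_add
  have h0 : IsPathConnected ({0}ᶜ : Set ℂ) := isPathConnected_compl_singleton_of_one_lt_rank hℂ 0
  have h0' : IsPathConnected ({0}ᶜ : Set (ℂ × ℂ)) :=
    isPathConnected_compl_singleton_of_one_lt_rank hℂ2 0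
  have h01 : IsPathConnected ({0, 1}ᶜ : Set ℂ) :=
    (Set.countable_singleton 1 |>.insert 0).isPathConnected_compl_of_one_lt_rank hℂ
  exact (isPathConnected_univ.prod (h0.prod h01)).prod (h0'.prod (isPathConnected_univ.prod
    ((h0.prod h0).prod ((h0.prod h0).prod h0'))))

/-- The three points of the upper half plane with given coordinates. -/
noncomputable def coordPoint (e : GenericCoord) : Fin 3 → ℂ :=
  ![upperMap e.1.1, upperMap (e.1.1 + e.1.2.1), upperMap (e.1.1 + e.1.2.1 * e.1.2.2)]

/-- The second direction with given coordinates. -/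
noncomputable def coordDir₁ (e : GenericCoord) : ℂ × ℂ :=
  blockAdj (coordPoint e 0) e.2.1 (e.2.2.1 0) (coordPoint e 1)
    (e.2.2.2.1.1 • e.2.1 + e.2.2.2.1.2 • quatJ e.2.1)

/-- The third direction with given coordinates. -/
noncomputable def coordDir₂ (e : GenericCoord) : ℂ × ℂ :=
  blockAdj (coordPoint e 1) (coordDir₁ e) (e.2.2.1 1) (coordPoint e 2)
    (blockAdj (coordPoint e 0) e.2.1 (e.2.2.1 0) (coordPoint e 2)
      (e.2.2.2.2.1.1 • e.2.1 + e.2.2.2.2.1.2 • quatJ e.2.1))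

/-- The parameters with given coordinates. -/
noncomputable def coordParam (e : GenericCoord) : CurveParam :=
  (coordPoint e, ![e.2.1, coordDir₁ e, coordDir₂ e], e.2.2.1, e.2.2.2.2.2)

theorem continuous_coordParam : Continuous coordParam := by
  have hz0 : Continuous fun e => coordPoint e 0 := continuous_upperMap.comp (by fun_prop)
  have hz1 : Continuous fun e => coordPoint e 1 := continuous_upperMap.comp (by fun_prop)
  have hz2 : Continuous fun e => coordPoint e 2 := continuous_upperMap.comp (by fun_prop)
  have ha : Continuous fun e : GenericCoord => e.2.1 := by fun_prop
  have haJ := ha.quatJ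
  have h1 : Continuous coordDir₁ := hz0.blockAdj ha (by fun_prop) hz1 (by fun_prop)
  have h2 : Continuous coordDir₂ :=
    hz1.blockAdj h1 (by fun_prop) hz2 (hz0.blockAdj ha (by fun_prop) hz2 (by fun_prop))
  refine (continuous_pi fun k => ?_).prodMk ((continuous_pi fun k => ?_).prodMk (by fun_prop))
  · fin_cases k
    · exact hz0
    · exact hz1
    · exact hz2
  · fin_cases k
    · exact ha
    · exact h1
    · exact h2

theorem det₂_combination (a : ℂ × ℂ) (α β : ℂ) :
    det₂ a (α • a + β • quatJ a) = β * sqNorm a := by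
  rw [ofReal_sqNorm]; simp [det₂, quatJ]; ring

theorem herm₂_combination (a : ℂ × ℂ) (α β : ℂ) :
    herm₂ a (α • a + β • quatJ a) = α * sqNorm a := by
  rw [ofReal_sqNorm]; simp [herm₂, quatJ]; ring

/-- The later directions are defined by adjugates so that, after transport by the outer blocks,
their data are nonzero multiples of `α a₀ + β J a₀`. The genericity conditions on these data become
`α ≠ 0` and `β ≠ 0`. -/
theorem isGenericParam_coordParam {e : GenericCoord} (he : e ∈ genericDomain) :
    IsGenericParam (coordParam e) := by
  simp only [genericDomain, Set.mem_prod, Set.mem_univ, true_and, Set.mem_compl_iff,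
    Set.mem_singleton_iff, Set.mem_insert_iff, not_or] at he
  obtain ⟨⟨hu, hs0, hs1⟩, ha, ⟨hα₁, hβ₁⟩, ⟨hα₂, hβ₂⟩, hc⟩ := he
  have him : ∀ k, 0 < (coordPoint e k).im := fun k => by
    fin_cases k <;> exact Real.exp_pos _
  have hne₁ : coordPoint e 1 ≠ coordPoint e 0 := fun h => hu <| by
    simpa using upperMap_injective h
  have hne₂ : coordPoint e 2 ≠ coordPoint e 0 := fun h => by
    have : e.1.1 + e.1.2.1 * e.1.2.2 = e.1.1 := upperMap_injective h
    simp [hu, hs0] at this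
  have hne₁₂ : coordPoint e 2 ≠ coordPoint e 1 := fun h => by
    have : e.1.1 + e.1.2.1 * e.1.2.2 = e.1.1 + e.1.2.1 := upperMap_injective h
    simp [hu, hs1] at this
  have hconj : ∀ k l, coordPoint e k ≠ conj (coordPoint e l) := fun k l =>
    ne_conj_of_im_pos (him l) (him k)
  have hn : (sqNorm e.2.1 : ℂ) ≠ 0 := Complex.ofReal_ne_zero.2 (sqNorm_pos ha).ne'
  have hK₁ := blockDet_ne_zero ha (e.2.2.1 0) hne₁ (hconj 1 0)
  have hK₂ := blockDet_ne_zero ha (e.2.2.1 0) hne₂ (hconj 2 0)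
  have hy₁ : blockEval (coordPoint e 0) e.2.1 (e.2.2.1 0) (coordPoint e 1) (coordDir₁ e)
      = blockDet (coordPoint e 0) e.2.1 (e.2.2.1 0) (coordPoint e 1) •
        (e.2.2.2.1.1 • e.2.1 + e.2.2.2.1.2 • quatJ e.2.1) := blockEval_blockAdj ..
  have ha₁ : coordDir₁ e ≠ 0 := by
    intro h0
    rw [h0, blockEval_zero] at hy₁
    have := congrArg (det₂ e.2.1) hy₁
    rw [det₂_smul, det₂_combination] at this
    simp [hK₁, hβ₁, hn, det₂] at this
  have hK₁₂ := blockDet_ne_zero ha₁ (e.2.2.1 1) hne₁₂ (hconj 2 1)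
  have hy₂ : blockEval (coordPoint e 0) e.2.1 (e.2.2.1 0) (coordPoint e 2)
      (blockEval (coordPoint e 1) (coordDir₁ e) (e.2.2.1 1) (coordPoint e 2) (coordDir₂ e))
      = (blockDet (coordPoint e 1) (coordDir₁ e) (e.2.2.1 1) (coordPoint e 2) *
        blockDet (coordPoint e 0) e.2.1 (e.2.2.1 0) (coordPoint e 2)) •
        (e.2.2.2.2.1.1 • e.2.1 + e.2.2.2.2.1.2 • quatJ e.2.1) := by
    rw [coordDir₂, blockEval_blockAdj, blockEval_smul, blockEval_blockAdj, smul_smul]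
  refine ⟨him, hne₁, hne₂, hne₁₂, hc, ?_, ?_, ?_, ?_⟩
  · change det₂ e.2.1 (blockEval (coordPoint e 0) e.2.1 (e.2.2.1 0) (coordPoint e 1)
      (coordDir₁ e)) ≠ 0
    rw [hy₁, det₂_smul, det₂_combination]
    exact mul_ne_zero hK₁ (mul_ne_zero hβ₁ hn)
  · change herm₂ e.2.1 (blockEval (coordPoint e 0) e.2.1 (e.2.2.1 0) (coordPoint e 1)
      (coordDir₁ e)) ≠ 0
    rw [hy₁, herm₂_smul, herm₂_combination]
    exact mul_ne_zero hK₁ (mul_ne_zero hα₁ hn)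
  · change det₂ e.2.1 (blockEval (coordPoint e 0) e.2.1 (e.2.2.1 0) (coordPoint e 2)
      (blockEval (coordPoint e 1) (coordDir₁ e) (e.2.2.1 1) (coordPoint e 2) (coordDir₂ e))) ≠ 0
    rw [hy₂, det₂_smul, det₂_combination]
    exact mul_ne_zero (mul_ne_zero hK₁₂ hK₂) (mul_ne_zero hβ₂ hn)
  · change herm₂ e.2.1 (blockEval (coordPoint e 0) e.2.1 (e.2.2.1 0) (coordPoint e 2)
      (blockEval (coordPoint e 1) (coordDir₁ e) (e.2.2.1 1) (coordPoint e 2) (coordDir₂ e))) ≠ 0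
    rw [hy₂, herm₂_smul, herm₂_combination]
    exact mul_ne_zero (mul_ne_zero hK₁₂ hK₂) (mul_ne_zero hα₂ hn)

theorem exists_smul_eq_combination {a y : ℂ × ℂ} {K : ℂ} (ha : a ≠ 0) (hK : K ≠ 0)
    (h1 : det₂ a y ≠ 0) (h2 : herm₂ a y ≠ 0) :
    ∃ α β : ℂ, α ≠ 0 ∧ β ≠ 0 ∧ α • a + β • quatJ a = K⁻¹ • y := by
  have hn : (sqNorm a : ℂ) ≠ 0 := Complex.ofReal_ne_zero.2 (sqNorm_pos ha).ne'
  refine ⟨K⁻¹ * ((sqNorm a : ℂ)⁻¹ * herm₂ a y), K⁻¹ * ((sqNorm a : ℂ)⁻¹ * det₂ a y),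
    by simp [hK, hn, h2], by simp [hK, hn, h1], ?_⟩
  simp only [mul_smul]
  rw [← smul_add, ← smul_add, ← sqNorm_smul_eq, smul_smul (sqNorm a : ℂ)⁻¹, inv_mul_cancel₀ hn,
    one_smul]

theorem IsGenericParam.exists_coord {d : CurveParam} (h : IsGenericParam d) :
    ∃ e ∈ genericDomain, coordParam e = d := by
  obtain ⟨z, a, ζ, c⟩ := d
  obtain ⟨him, hne₁, hne₂, hne₁₂, hc, hdet₁, hherm₁, hdet₂, hherm₂⟩ := id h
  have ha := h.dir_ne_zero
  simp only at him hne₁ hne₂ hne₁₂ hc hdet₁ hherm₁ hdet₂ hherm₂ ha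
  have hconj : ∀ k l, z k ≠ conj (z l) := fun k l => ne_conj_of_im_pos (him l) (him k)
  obtain ⟨v₀, hv₀⟩ := exists_upperMap_eq (him 0)
  obtain ⟨v₁, hv₁⟩ := exists_upperMap_eq (him 1)
  obtain ⟨v₂, hv₂⟩ := exists_upperMap_eq (him 2)
  have hu : v₁ - v₀ ≠ 0 := fun h => hne₁ (by rw [← hv₁, ← hv₀, sub_eq_zero.1 h])
  have hs : v₂ - v₀ ≠ 0 := fun h => hne₂ (by rw [← hv₂, ← hv₀, sub_eq_zero.1 h])
  have hs1 : (v₂ - v₀) / (v₁ - v₀) ≠ 1 := fun h => hne₁₂ (by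
    rw [div_eq_one_iff_eq hu, sub_left_inj] at h
    rw [← hv₂, ← hv₁, h])
  have hK₁ := blockDet_ne_zero (ha 0) (ζ 0) hne₁ (hconj 1 0)
  have hK₂ := blockDet_ne_zero (ha 0) (ζ 0) hne₂ (hconj 2 0)
  have hK₁₂ := blockDet_ne_zero (ha 1) (ζ 1) hne₁₂ (hconj 2 1)
  obtain ⟨α₁, β₁, hα₁, hβ₁, e₁⟩ := exists_smul_eq_combination (ha 0) hK₁ hdet₁ hherm₁
  obtain ⟨α₂, β₂, hα₂, hβ₂, e₂⟩ :=
    exists_smul_eq_combination (ha 0) (mul_ne_zero hK₁₂ hK₂) hdet₂ hherm₂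
  -- A difference and a ratio of differences turn three distinct points into the product conditions
  -- `u ≠ 0` and `s ≠ 0, 1`. The `α`, `β` already carry the inverse of the determinants produced by
  -- composing blocks with their adjugates.
  let e : GenericCoord :=
    ((v₀, v₁ - v₀, (v₂ - v₀) / (v₁ - v₀)), a 0, ζ, (α₁, β₁), (α₂, β₂), c)
  have hz : coordPoint e = z := by
    funext k
    fin_cases k
    · exact hv₀
    · change upperMap (v₀ + (v₁ - v₀)) = z 1
      rw [add_sub_cancel, hv₁]
    · change upperMap (v₀ + (v₁ - v₀) * ((v₂ - v₀) / (v₁ - v₀))) = z 2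
      rw [mul_div_cancel₀ _ hu, add_sub_cancel, hv₂]
  have h1 : coordDir₁ e = a 1 := by
    change blockAdj (coordPoint e 0) (a 0) (ζ 0) (coordPoint e 1) (α₁ • a 0 + β₁ • quatJ (a 0)) = _
    rw [hz, e₁, blockAdj_smul, blockAdj_blockEval, smul_smul, inv_mul_cancel₀ hK₁, one_smul]
  have h2 : coordDir₂ e = a 2 := by
    change blockAdj (coordPoint e 1) (coordDir₁ e) (ζ 1) (coordPoint e 2)
      (blockAdj (coordPoint e 0) (a 0) (ζ 0) (coordPoint e 2) (α₂ • a 0 + β₂ • quatJ (a 0))) = _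
    rw [h1, hz, e₂, blockAdj_smul, blockAdj_blockEval, smul_smul, blockAdj_smul,
      blockAdj_blockEval, smul_smul]
    convert one_smul ℂ (a 2) using 2
    field_simp
  refine ⟨e, ?_, ?_⟩
  · simp only [genericDomain, Set.mem_prod, Set.mem_univ, true_and, Set.mem_compl_iff,
      Set.mem_singleton_iff, Set.mem_insert_iff, not_or]
    exact ⟨⟨hu, div_ne_zero hs hu, hs1⟩, ha 0, ⟨hα₁, hβ₁⟩, ⟨hα₂, hβ₂⟩, hc⟩
  · refine Prod.ext hz (Prod.ext (funext fun k => ?_) rfl)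
    fin_cases k
    · rfl
    · exact h1
    · exact h2

theorem isPathConnected_genericParam : IsPathConnected {d | IsGenericParam d} := by
  have : {d | IsGenericParam d} = coordParam '' genericDomain := by
    ext d
    constructor
    · intro h
      exact h.exists_coord
    · rintro ⟨e, he, rfl⟩
      exact isGenericParam_coordParam he
  rw [this]
  exact isPathConnected_genericDomain.image continuous_coordParam

/-! ### Moving arbitrary parameters into the generic locus along segments. -/

/-- On the line through `x` and `y` the function is real-analytic in `τ` and nonzero at `τ = 1`, so
its zeros are isolated. Real analyticity is what is available, since conjugation enters the
formulas. -/
theorem eventually_ne_zero_of_analytic {E : Type*} [NormedAddCommGroup E] [NormedSpace ℝ E]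
    {G : E → ℂ} (hG : ∀ x, AnalyticAt ℝ G x) (x : E) {y : E} (hy : G y ≠ 0) :
    ∀ᶠ τ : ℝ in 𝓝[≠] 0, G (x + τ • (y - x)) ≠ 0 := by
  have hline : ∀ τ : ℝ, AnalyticAt ℝ (fun τ : ℝ => G (x + τ • (y - x))) τ := fun τ =>
    (hG _).fun_comp (analyticAt_const.add (analyticAt_id.smul analyticAt_const))
  refine (hline 0).eventually_eq_zero_or_eventually_ne_zero.resolve_left fun h0 => hy ?_
  have h := AnalyticOnNhd.eqOn_zero_of_preconnected_of_eventuallyEq_zero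
    (fun τ _ => hline τ) isPreconnected_univ (Set.mem_univ 0) h0 (Set.mem_univ 1)
  simpa using h

section Analytic

variable {E : Type*} [NormedAddCommGroup E] [NormedSpace ℝ E]

theorem AnalyticAt.complex_conj {f : E → ℂ} {x : E} (hf : AnalyticAt ℝ f x) :
    AnalyticAt ℝ (fun y => conj (f y)) x :=
  (Complex.conjCLE.toContinuousLinearMap.analyticAt (f x)).fun_comp hf

theorem AnalyticAt.fst' {f : E → ℂ × ℂ} {x : E} (hf : AnalyticAt ℝ f x) :
    AnalyticAt ℝ (fun y => (f y).1) x := analyticAt_fst.fun_comp hf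

theorem AnalyticAt.snd' {f : E → ℂ × ℂ} {x : E} (hf : AnalyticAt ℝ f x) :
    AnalyticAt ℝ (fun y => (f y).2) x := analyticAt_snd.fun_comp hf

theorem AnalyticAt.herm₂ {a y : E → ℂ × ℂ} {x : E} (ha : AnalyticAt ℝ a x)
    (hy : AnalyticAt ℝ y x) : AnalyticAt ℝ (fun x => herm₂ (a x) (y x)) x :=
  (ha.fst'.complex_conj.mul hy.fst').add (ha.snd'.complex_conj.mul hy.snd')

theorem AnalyticAt.det₂ {a y : E → ℂ × ℂ} {x : E} (ha : AnalyticAt ℝ a x)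
    (hy : AnalyticAt ℝ y x) : AnalyticAt ℝ (fun x => det₂ (a x) (y x)) x :=
  (ha.fst'.mul hy.snd').sub (ha.snd'.mul hy.fst')

theorem AnalyticAt.linEval {z t : E → ℂ} {a y : E → ℂ × ℂ} {x : E} (hz : AnalyticAt ℝ z x)
    (ha : AnalyticAt ℝ a x) (ht : AnalyticAt ℝ t x) (hy : AnalyticAt ℝ y x) :
    AnalyticAt ℝ (fun x => linEval (z x) (a x) (t x) (y x)) x := by
  have h1 := (ht.sub hz.complex_conj).mul (ha.herm₂ hy)
  have h2 := (ht.sub hz).mul (ha.det₂ hy)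
  exact ((h1.mul ha.fst').sub (h2.mul ha.snd'.complex_conj)).prod
    ((h1.mul ha.snd').add (h2.mul ha.fst'.complex_conj))

theorem AnalyticAt.blockEval {z t ζ : E → ℂ} {a y : E → ℂ × ℂ} {x : E} (hz : AnalyticAt ℝ z x)
    (ha : AnalyticAt ℝ a x) (hζ : AnalyticAt ℝ ζ x) (ht : AnalyticAt ℝ t x)
    (hy : AnalyticAt ℝ y x) :
    AnalyticAt ℝ (fun x => blockEval (z x) (a x) (ζ x) (t x) (y x)) x := by
  refine hz.linEval ha ht (hz.linEval (ha.add ?_) ht hy)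
  exact (hζ.mul ha.snd'.complex_conj.neg).prod (hζ.mul ha.fst'.complex_conj)

end Analytic

theorem analyticAt_point (k : Fin 3) (d : CurveParam) :
    AnalyticAt ℝ (fun d : CurveParam => d.1 k) d :=
  ((ContinuousLinearMap.proj (R := ℝ) (φ := fun _ : Fin 3 => ℂ) k).analyticAt _).fun_comp
    analyticAt_fst

theorem analyticAt_dir (k : Fin 3) (d : CurveParam) :
    AnalyticAt ℝ (fun d : CurveParam => d.2.1 k) d :=
  ((ContinuousLinearMap.proj (R := ℝ) (φ := fun _ : Fin 3 => ℂ × ℂ) k).analyticAt _).fun_comp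
    (analyticAt_fst.fun_comp analyticAt_snd)

theorem analyticAt_shift (k : Fin 3) (d : CurveParam) :
    AnalyticAt ℝ (fun d : CurveParam => d.2.2.1 k) d :=
  ((ContinuousLinearMap.proj (R := ℝ) (φ := fun _ : Fin 3 => ℂ) k).analyticAt _).fun_comp
    (analyticAt_fst.fun_comp (analyticAt_snd.fun_comp analyticAt_snd))

/-- On the segment from any parameters to generic ones, nearby parameters are generic. -/
theorem eventually_isGenericParam {d d' : CurveParam} (him : ∀ k, 0 < (d.1 k).im)
    (hc : d.2.2.2 ≠ 0) (hd' : IsGenericParam d') (hcc : d'.2.2.2 = d.2.2.2) :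
    ∀ᶠ τ : ℝ in 𝓝[>] 0, IsGenericParam (d + τ • (d' - d)) := by
  have key : ∀ G : CurveParam → ℂ, (∀ d, AnalyticAt ℝ G d) → G d' ≠ 0 →
      ∀ᶠ τ : ℝ in 𝓝[>] 0, G (d + τ • (d' - d)) ≠ 0 := fun G hG h =>
    (eventually_ne_zero_of_analytic hG d h).filter_mono
      (nhdsWithin_mono 0 fun _ h => ne_of_gt h)
  have hz := analyticAt_point
  have ha := analyticAt_dir
  have hζ := analyticAt_shift
  have hy₁ : ∀ d, AnalyticAt ℝ (fun d : CurveParam =>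
      blockEval (d.1 0) (d.2.1 0) (d.2.2.1 0) (d.1 1) (d.2.1 1)) d := fun d =>
    (hz 0 d).blockEval (ha 0 d) (hζ 0 d) (hz 1 d) (ha 1 d)
  have hy₂ : ∀ d, AnalyticAt ℝ (fun d : CurveParam =>
      blockEval (d.1 0) (d.2.1 0) (d.2.2.1 0) (d.1 2)
        (blockEval (d.1 1) (d.2.1 1) (d.2.2.1 1) (d.1 2) (d.2.1 2))) d := fun d =>
    (hz 0 d).blockEval (ha 0 d) (hζ 0 d) (hz 2 d)
      ((hz 1 d).blockEval (ha 1 d) (hζ 1 d) (hz 2 d) (ha 2 d))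
  filter_upwards [key _ (fun d => (hz 1 d).sub (hz 0 d)) (sub_ne_zero.2 hd'.ne₁),
    key _ (fun d => (hz 2 d).sub (hz 0 d)) (sub_ne_zero.2 hd'.ne₂),
    key _ (fun d => (hz 2 d).sub (hz 1 d)) (sub_ne_zero.2 hd'.ne₁₂),
    key _ (fun d => (ha 0 d).det₂ (hy₁ d)) hd'.det₁,
    key _ (fun d => (ha 0 d).herm₂ (hy₁ d)) hd'.herm₁,
    key _ (fun d => (ha 0 d).det₂ (hy₂ d)) hd'.det₂,
    key _ (fun d => (ha 0 d).herm₂ (hy₂ d)) hd'.herm₂,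
    Ioo_mem_nhdsGT (zero_lt_one' ℝ)] with τ h1 h2 h3 h4 h5 h6 h7 hτ
  refine ⟨fun k => ?_, sub_ne_zero.1 h1, sub_ne_zero.1 h2, sub_ne_zero.1 h3, ?_, h4, h5, h6, h7⟩
  · have e : ((d + τ • (d' - d)).1 k).im = (1 - τ) * (d.1 k).im + τ * (d'.1 k).im := by
      simp; ring
    rw [e]
    exact add_pos (mul_pos (by linarith [hτ.2]) (him k)) (mul_pos hτ.1 (hd'.im_pos k))
  · have e : (d + τ • (d' - d)).2.2.2 = d.2.2.2 := by
      simp [hcc]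
    rwa [e]

/-! ### Assembly: paths in projective space. -/

/-- A regular map to the sphere with `p₀ > 0` is joined to one with generic parameters, through
maps that have generic parameters except at the starting point. -/
theorem exists_joinedIn_generic {S : Set (FormTuple 6)}
    (hgen : ∀ d, IsGenericParam d → paramForm d ∈ S) {p : FormTuple 6} (hpS : p ∈ S)
    (hp : NoCommonRoot p) (hs : LiesInSphere p) (hpos : ∀ x : ℝ, 0 < (formPoly p 0).eval x) :
    ∃ d, IsGenericParam d ∧ JoinedIn S p (paramForm d) := by
  obtain ⟨d, him, hc, rfl⟩ := exists_paramForm_eq hp hs hpos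
  obtain ⟨d₁, hd₁⟩ := isPathConnected_genericParam.nonempty
  -- Keeping the vector `c` of `d` makes it constant, hence nonzero, on the segment; the upper half
  -- plane is convex, so the imaginary parts stay positive.
  let d' : CurveParam := (d₁.1, d₁.2.1, d₁.2.2.1, d.2.2.2)
  have hd' : IsGenericParam d' := { hd₁ with vec_ne := hc }
  obtain ⟨ε, hε, hεg⟩ :=
    mem_nhdsGT_iff_exists_Ioc_subset.1 (eventually_isGenericParam him hc hd' rfl)
  have hε' : (0 : ℝ) < ε := hε
  refine ⟨d + ε • (d' - d), hεg ⟨hε', le_rfl⟩,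
    JoinedIn.ofLine (f := fun τ => paramForm (d + (τ * ε) • (d' - d))) ?_ (by simp) (by simp) ?_⟩
  · exact (continuous_paramForm.comp (by fun_prop)).continuousOn
  · rintro _ ⟨τ, hτ, rfl⟩
    rcases hτ.1.eq_or_lt with h0 | h0
    · simpa [← h0] using hpS
    · exact hgen _ (hεg ⟨mul_pos h0 hε', mul_le_of_le_one_left hε'.le hτ.2⟩)

theorem joinedIn_projectivization {V : Type*} [AddCommGroup V] [Module ℝ V] [TopologicalSpace V]
    {S : Set V} {T : Set (ℙ ℝ V)} (h0 : ∀ p ∈ S, p ≠ 0)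
    (hT : ∀ p (hp : p ∈ S), Projectivization.mk ℝ p (h0 p hp) ∈ T) {p q : V}
    (h : JoinedIn S p q) : JoinedIn T (Projectivization.mk ℝ p (h0 p h.source_mem))
      (Projectivization.mk ℝ q (h0 q h.target_mem)) := by
  have hcont : Continuous fun x : S => Projectivization.mk ℝ x.1 (h0 x.1 x.2) :=
    continuous_quotient_mk'.comp (continuous_subtype_val.subtype_mk fun x => h0 x.1 x.2)
  obtain ⟨γ⟩ := h.joined_subtype
  exact ⟨γ.map hcont, fun t => hT _ (γ t).2⟩

/-- The same argument serves all maps and the birational ones, because the joining paths are generic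
except at their starting point, which lies in `S` by assumption. -/
theorem isPathConnected_of_generic {T : Set (ℙ ℝ (FormTuple 6))} {S : Set (FormTuple 6)}
    (hT : ∀ p hp, Projectivization.mk ℝ p hp ∈ T ↔ p ∈ S)
    (hS : ∀ p ∈ S, NoCommonRoot p ∧ LiesInSphere p)
    (hgen : ∀ d, IsGenericParam d → paramForm d ∈ S) : IsPathConnected T := by
  have h0 : ∀ p ∈ S, p ≠ 0 := by
    rintro p hp rfl
    refine (hS 0 hp).1 ![1, 0] (fun h => one_ne_zero (congrFun h 0)) ?_
    ext i
    simp [evalTuple]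
  have hmk : ∀ p (hp : p ∈ S), Projectivization.mk ℝ p (h0 p hp) ∈ T := fun p hp =>
    (hT p _).2 hp
  obtain ⟨d₀, hd₀⟩ := isPathConnected_genericParam.nonempty
  refine ⟨_, hmk _ (hgen d₀ hd₀), fun {k} hk => JoinedIn.symm ?_⟩
  have key : ∀ p (hp : p ∈ S), (∀ x : ℝ, 0 < (formPoly p 0).eval x) →
      JoinedIn T (Projectivization.mk ℝ p (h0 p hp))
        (Projectivization.mk ℝ (paramForm d₀) (h0 _ (hgen d₀ hd₀))) := by
    intro p hp hpos
    obtain ⟨d, hd, hj⟩ := exists_joinedIn_generic hgen hp (hS p hp).1 (hS p hp).2 hpos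
    have hj' : JoinedIn S (paramForm d) (paramForm d₀) :=
      ((isPathConnected_genericParam.joinedIn d hd d₀ hd₀).map continuous_paramForm).mono (by
        rintro _ ⟨d, hd, rfl⟩
        exact hgen d hd)
    exact joinedIn_projectivization h0 hmk (hj.trans hj')
  induction k using Projectivization.ind with
  | h p hp =>
    have hpS := (hT p hp).1 hk
    rcases formPoly_zero_pos_or_neg (hS p hpS).1 (hS p hpS).2 with hpos | hneg
    · exact key p hpS hpos
    -- A tuple and its negative are the same projective point, so the two signs of `p₀` do not give
    -- two components.
    · have hneg' : ∀ x : ℝ, 0 < (formPoly (-p) 0).eval x := fun x => by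
        have : formPoly (-p) 0 = -formPoly p 0 := by simp [formPoly]
        rw [this, eval_neg]
        linarith [hneg x]
      have hmk' : Projectivization.mk ℝ (-p) (neg_ne_zero.2 hp) = Projectivization.mk ℝ p hp :=
        (Projectivization.mk_eq_mk_iff' ..).2 ⟨-1, by simp⟩
      have hnS : -p ∈ S := (hT (-p) (neg_ne_zero.2 hp)).1 (hmk' ▸ hk)
      have := key (-p) hnS hneg'
      rwa [hmk'] at this

theorem mainTheorem6 :
    IsPathConnected (sphereMaps 6) ∧
    IsPathConnected (sphereParametrizations 6) ∧
    PathConnectedSpace (SphereCurves 6) := by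
  have h : IsPathConnected (sphereParametrizations 6) :=
    isPathConnected_of_generic
      (S := {p | ∃ h : NoCommonRoot p, LiesInSphere p ∧ IsBirationalOntoImage p h})
      mk_mem_sphereParametrizations (fun p hp => ⟨hp.1, hp.2.1⟩)
      fun d hd => ⟨hd.noCommonRoot, liesInSphere_paramForm d, hd.isBirational⟩
  refine ⟨?_, h, ?_⟩
  · exact isPathConnected_of_generic (S := {p | NoCommonRoot p ∧ LiesInSphere p})
      mk_mem_sphereMaps (fun p hp => hp) fun d hd => ⟨hd.noCommonRoot, liesInSphere_paramForm d⟩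
  · have := isPathConnected_iff_pathConnectedSpace.1 h
    infer_instance
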